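/- For a compact group $G$ with Haar measure $\mu$ normalized so that $\mu(G)=1$, let $$\mathrm{pf}(G)=\sup\{\mu(A) : A\subseteq G \text{ measurable},\ A\cap A^2=\emptyset\},\qquad A^2=\{ab : a,b\in A\},$$ be the product-free measure of $G$. Let $p$ be a prime number, let $\mathbb{Z}_p$ be the ring of $p$-adic integers, and let $\mathrm{SL}_k(\mathbb{Z}_p)$ and $\mathrm{Sp}_{2k}(\mathbb{Z}_p)=\{A\in \mathrm{GL}_{2k}(\mathbb{Z}_p) : AJA^{T}=J\}$, where $J=\begin{pmatrix}0&I_k\\-I_k&0\end{pmatrix}$, carry their profinite ($p$-adic) topologies. Then $$\frac{1}{p+1}\le \mathrm{pf}(\mathrm{SL}_2(\mathbb{Z}_p))\le\left(\frac{p-1}{2}\right)^{-1/3},$$ $$\frac{p-1}{p^k-1}\le \mathrm{pf}(\mathrm{SL}_k(\mathbb{Z}_p))\le\left(p^{k-1}-p^{k-2}\right)^{-1/3}\qquad\text{for all } k\ge 3,$$ $$\frac{p-1}{p^{2k}-1}\le \mathrm{pf}(\mathrm{Sp}_{2k}(\mathbb{Z}_p))\le\left(\tfrac12 (p-1)p^{k-1}\right)^{-1/3}\qquad\text{for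 all } k\ge 2.$$ -/

import Mathlib

open MeasureTheory

open scoped Pointwise

/-- The Haar measure of a compact group, on its Borel σ-algebra, normalized so that the whole
group has measure `1`. -/
noncomputable def normalizedHaar (G : Type*) [Group G] [TopologicalSpace G] [IsTopologicalGroup G]
    [CompactSpace G] : @Measure G (borel G) :=
  letI : MeasurableSpace G := borel G
  haveI : BorelSpace G := ⟨rfl⟩
  Measure.haarMeasure ⊤

theorem normalizedHaar_univ (G : Type*) [Group G] [TopologicalSpace G] [IsTopologicalGroup G]
    [CompactSpace G] : normalizedHaar G Set.univ = 1 := by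
  let _ : MeasurableSpace G := borel G
  have _ : BorelSpace G := ⟨rfl⟩
  exact Measure.haarMeasure_self (K₀ := (⊤ : TopologicalSpace.PositiveCompacts G))

/-- The measures of the Borel product-free subsets `A` of `G`, i.e. those with `A ∩ A² = ∅`. -/
def productFreeMeasures (G : Type*) [Group G] [TopologicalSpace G] [IsTopologicalGroup G]
    [CompactSpace G] : Set ℝ :=
  {r | ∃ A : Set G, MeasurableSet[borel G] A ∧ A ∩ (A * A) = ∅ ∧ r = (normalizedHaar G A).toReal}

/-- The product-free measure of a compact group. -/
noncomputable def productFreeMeasure (G : Type*) [Group G] [TopologicalSpace G]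
    [IsTopologicalGroup G] [CompactSpace G] : ℝ :=
  sSup (productFreeMeasures G)

/-- The supremum is over a nonempty set bounded above, so it is a genuine one. -/
theorem isLUB_productFreeMeasure (G : Type*) [Group G] [TopologicalSpace G]
    [IsTopologicalGroup G] [CompactSpace G] :
    IsLUB (productFreeMeasures G) (productFreeMeasure G) := by
  refine isLUB_csSup ⟨0, ∅, ?_, by simp, by simp⟩ ⟨1, ?_⟩
  · exact @MeasurableSet.empty G (borel G)
  · rintro r ⟨A, -, -, rfl⟩
    have h : normalizedHaar G A ≤ 1 :=
      (measure_mono (Set.subset_univ A)).trans (normalizedHaar_univ G).le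
    simpa using ENNReal.toReal_mono ENNReal.one_ne_top h

instance specialLinearGroup_compactSpace (p : ℕ) [Fact p.Prime] (k : ℕ) :
    CompactSpace (Matrix.SpecialLinearGroup (Fin k) ℤ_[p]) := by
  have : CompactSpace (Matrix (Fin k) (Fin k) ℤ_[p]) :=
    inferInstanceAs (CompactSpace (Fin k → Fin k → ℤ_[p]))
  refine isCompact_iff_compactSpace.mp
    (IsClosed.isCompact (s := {A : Matrix (Fin k) (Fin k) ℤ_[p] | A.det = 1}) ?_)
  exact isClosed_eq (Continuous.matrix_det continuous_id) continuous_const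

instance symplecticGroup_isTopologicalGroup (p : ℕ) [Fact p.Prime] (k : ℕ) :
    IsTopologicalGroup (Matrix.symplecticGroup (Fin k) ℤ_[p]) where
  continuous_mul := continuous_mul
  continuous_inv := by
    refine Continuous.subtype_mk ?_ _
    exact (continuous_const.matrix_mul continuous_subtype_val.matrix_transpose).matrix_mul
      continuous_const

instance symplecticGroup_compactSpace (p : ℕ) [Fact p.Prime] (k : ℕ) :
    CompactSpace (Matrix.symplecticGroup (Fin k) ℤ_[p]) := by
  have : CompactSpace (Matrix (Fin k ⊕ Fin k) (Fin k ⊕ Fin k) ℤ_[p]) :=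
    inferInstanceAs (CompactSpace (Fin k ⊕ Fin k → Fin k ⊕ Fin k → ℤ_[p]))
  have h : IsClosed {A : Matrix (Fin k ⊕ Fin k) (Fin k ⊕ Fin k) ℤ_[p] |
      A * Matrix.J (Fin k) ℤ_[p] * A.transpose = Matrix.J (Fin k) ℤ_[p]} :=
    isClosed_eq ((continuous_id.matrix_mul continuous_const).matrix_mul
      continuous_id.matrix_transpose) continuous_const
  exact isCompact_iff_compactSpace.mp h.isCompact

/-!
# Product-free sets in special linear and symplectic groups over the `p`-adic integers

*Lower bounds.* A nontrivial coset of a subgroup `H` is product-free, so the product-free measure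
is at least `1 / [G : H]`. For `H` take the stabilizer of a line in the reduction modulo `p`; its
index is at most the number of points of the projective space
(`div_le_productFreeMeasure_of_hom`).

*Upper bounds.* If every nontrivial representation of `G` has dimension at least `D`
(`HasMinDegree`), then the product-free measure is at most `D ^ (-1 / 3)`
(`productFreeMeasure_le`). By inner regularity and compactness this reduces to a product-free
subset `S` of a finite quotient `Γ`. Convolution by the balanced function `1_S - |S| / |Γ|` commutes
with right translation, so the eigenspaces of `T* T` are representations without invariants and have
dimension at least `D`; comparing with the Hilbert-Schmidt norm bounds the norm of `T`
(`norm_convolutionOperator_sq_le`), while product-freeness forces `⟪1_S, T 1_S⟫ = -|S| ^ 3 / |Γ|`.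

*Minimal degrees.* A representation that is nontrivial on an abelian unipotent subgroup `A` contains
a nontrivial character of `A`, together with all its conjugates under the normalizer of `A`, so its
dimension is at least the number of conjugates (`exists_addChar_card_le_finrank`). Two multiples
`t ↦ ψ (t a)`, `t ↦ ψ (t b)` of a nontrivial character of `ℤ_[p]` differ as soon as `a - b` is a
unit, which makes the conjugates easy to tell apart. For `SL` the group `A` consists of the matrices
`1 + e_i xᵀ`, for `Sp` it is the unipotent radical of the Siegel parabolic. That a nontrivial
representation is nontrivial on a given kind of root subgroup follows from the generation of these
groups over a local ring (`Matrix.SpecialLinearGroup.eq_top_of_transvection_mem`,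
`SymplecticGroup.eq_top_of_upper_mem`). For `Sp` and odd `p` the character is chosen nontrivial on a
long root subgroup; the conjugation action there involves a factor `2`, so for `p = 2` a short root
subgroup is used instead.
-/

universe u

/-! ### Minimal degrees of representations -/

/-- A group has minimal degree at least `D` if every nontrivial finite-dimensional complex
representation of finite exponent has dimension at least `D`. The condition on the exponent is
satisfied by every representation that factors through a finite quotient. -/
def HasMinDegree (D : ℝ) (G : Type u) [Group G] : Prop :=
  ∀ (V : Type u) [AddCommGroup V] [Module ℂ V] [FiniteDimensional ℂ V] (ρ : G →* Module.End ℂ V),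
    (∃ m : ℕ, 0 < m ∧ ∀ g, ρ g ^ m = 1) → (∃ g, ρ g ≠ 1) → D ≤ Module.finrank ℂ V

theorem HasMinDegree.of_surjective {D : ℝ} {G H : Type u} [Group G] [Group H]
    (hG : HasMinDegree D G) (f : G →* H) (hf : Function.Surjective f) : HasMinDegree D H := by
  intro V _ _ _ ρ hρ hne
  obtain ⟨m, hm, hpow⟩ := hρ
  obtain ⟨h, hh⟩ := hne
  obtain ⟨g, rfl⟩ := hf h
  exact hG V (ρ.comp f) ⟨m, hm, fun g => hpow (f g)⟩ ⟨g, hh⟩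

theorem finrank_pos_of_map_ne_one {V M : Type*} [AddCommGroup V] [Module ℂ V]
    [FiniteDimensional ℂ V] {f : M → Module.End ℂ V} (h : ∃ g, f g ≠ 1) :
    0 < Module.finrank ℂ V := by
  obtain ⟨g, hg⟩ := h
  have : Nontrivial V := by
    by_contra hV
    rw [not_nontrivial_iff_subsingleton] at hV
    exact hg (LinearMap.ext fun v => Subsingleton.elim _ _)
  exact Module.finrank_pos

theorem maxGenEigenspace_eq_eigenspace_of_pow_eq_one {V : Type*} [AddCommGroup V] [Module ℂ V]
    [FiniteDimensional ℂ V] {T : Module.End ℂ V} {m : ℕ} (hm : 0 < m) (hT : T ^ m = 1) (μ : ℂ) :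
    T.maxGenEigenspace μ = T.eigenspace μ := by
  refine Module.End.IsFinitelySemisimple.maxGenEigenspace_eq_eigenspace ?_ μ
  refine (Module.End.isSemisimple_of_squarefree_aeval_eq_zero
    (p := Polynomial.X ^ m - 1) ?_ ?_).isFinitelySemisimple
  · exact (Polynomial.separable_X_pow_sub_C (1 : ℂ) (by exact_mod_cast hm.ne') one_ne_zero).squarefree
  · simp [hT]

theorem exists_joint_eigenvector {V ι : Type*} [AddCommGroup V] [Module ℂ V]
    [FiniteDimensional ℂ V] (σ : ι → Module.End ℂ V) (hc : ∀ i j, Commute (σ i) (σ j))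
    {m : ℕ} (hm : 0 < m) (hpow : ∀ i, σ i ^ m = 1) {i₀ : ι} (hne : σ i₀ ≠ 1) :
    ∃ χ : ι → ℂ, χ i₀ ≠ 1 ∧ ∃ v ≠ 0, ∀ i, σ i v = χ i • v := by
  by_contra! hcon
  have htop := Module.End.iSup_iInf_maxGenEigenspace_eq_top_of_iSup_maxGenEigenspace_eq_top_of_commute
    σ (fun i j _ => hc i j) (fun i => Module.End.iSup_maxGenEigenspace_eq_top (σ i))
  simp only [maxGenEigenspace_eq_eigenspace_of_pow_eq_one hm (hpow _)] at htop
  have hle : (⊤ : Submodule ℂ V) ≤ (σ i₀).eigenspace 1 := by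
    rw [← htop]
    refine iSup_le fun χ => ?_
    by_cases hχ : χ i₀ = 1
    · exact hχ ▸ iInf_le _ i₀
    · intro v hv
      by_cases hv0 : v = 0
      · simp [hv0]
      · obtain ⟨i, hi⟩ := hcon χ hχ v hv0
        exact absurd (Module.End.mem_eigenspace_iff.1 ((Submodule.mem_iInf _).1 hv i)) hi
  refine hne (LinearMap.ext fun v => ?_)
  simpa using Module.End.mem_eigenspace_iff.1 (hle (Submodule.mem_top (x := v)))

theorem card_le_finrank_of_joint_eigenvectors {V ι κ : Type*} [AddCommGroup V] [Module ℂ V]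
    [FiniteDimensional ℂ V] [Fintype κ] (σ : ι → Module.End ℂ V)
    (hc : ∀ i j, Commute (σ i) (σ j)) (χ : κ → ι → ℂ) (hχ : Function.Injective χ)
    (v : κ → V) (hv0 : ∀ a, v a ≠ 0) (hv : ∀ a i, σ i (v a) = χ a i • v a) :
    Fintype.card κ ≤ Module.finrank ℂ V := by
  have hind := (Module.End.independent_iInf_maxGenEigenspace_of_forall_mapsTo σ
    (fun i j φ => Module.End.mapsTo_maxGenEigenspace_of_comm (hc j i) φ)).comp hχ
  refine (hind.linearIndependent _ (v := v) (fun a => ?_) hv0).fintype_card_le_finrank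
  refine (Submodule.mem_iInf _).2 fun i => ?_
  exact Module.End.mem_maxGenEigenspace _ _ _ |>.2 ⟨1, by simp [hv]⟩

/-! ### Convolution operators on a finite group -/

section FiniteGroup

variable {Γ : Type u} [Group Γ]

/-- The right regular representation `(R g f) x = f (x g)`. -/
noncomputable def rightRegular : Γ →* Module.End ℂ (EuclideanSpace ℂ Γ) where
  toFun g :=
    { toFun := fun f => WithLp.toLp 2 fun x => f (x * g)
      map_add' := fun f h => by ext x; simp
      map_smul' := fun c f => by ext x; simp }
  map_one' := by
    ext f x
    simp
  map_mul' g h := by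
    ext f x
    simp [mul_assoc]

@[simp]
theorem rightRegular_apply (g : Γ) (f : EuclideanSpace ℂ Γ) (x : Γ) :
    rightRegular g f x = f (x * g) := rfl

variable [Fintype Γ]

/-- The operator `f ↦ (x ↦ ∑ y, K (x y⁻¹) f y)` of convolution by `K` on functions on a finite
group. -/
noncomputable def convolutionOperator (K : Γ → ℝ) :
    EuclideanSpace ℂ Γ →ₗ[ℂ] EuclideanSpace ℂ Γ where
  toFun f := WithLp.toLp 2 fun x => ∑ y, (K (x * y⁻¹) : ℂ) * f y
  map_add' f g := by
    ext x
    simp [mul_add, Finset.sum_add_distrib]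
  map_smul' c f := by
    ext x
    simp [Finset.mul_sum, mul_left_comm]

@[simp]
theorem convolutionOperator_apply (K : Γ → ℝ) (f : EuclideanSpace ℂ Γ) (x : Γ) :
    convolutionOperator K f x = ∑ y, (K (x * y⁻¹) : ℂ) * f y := rfl

theorem inner_rightRegular_left (g : Γ) (f h : EuclideanSpace ℂ Γ) :
    inner ℂ (rightRegular g f) h = inner ℂ f (rightRegular g⁻¹ h) := by
  simp only [PiLp.inner_apply, rightRegular_apply]
  refine Fintype.sum_equiv (Equiv.mulRight g) _ _ fun x => ?_
  simp

theorem convolutionOperator_rightRegular (K : Γ → ℝ) (g : Γ) (f : EuclideanSpace ℂ Γ) :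
    convolutionOperator K (rightRegular g f) = rightRegular g (convolutionOperator K f) := by
  ext x
  simp only [convolutionOperator_apply, rightRegular_apply]
  refine Fintype.sum_equiv (Equiv.mulRight g) _ _ fun y => ?_
  simp [mul_assoc]

theorem adjoint_convolutionOperator_rightRegular (K : Γ → ℝ) (g : Γ) (f : EuclideanSpace ℂ Γ) :
    (convolutionOperator K).adjoint (rightRegular g f) =
      rightRegular g ((convolutionOperator K).adjoint f) := by
  refine ext_inner_right ℂ fun h => ?_
  rw [LinearMap.adjoint_inner_left, inner_rightRegular_left, inner_rightRegular_left,
    LinearMap.adjoint_inner_left, convolutionOperator_rightRegular]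

/-- Bessel's inequality for the rows of the convolution operator. -/
theorem sum_norm_convolutionOperator_sq_le (K : Γ → ℝ) {ι : Type*} [Fintype ι]
    {b : ι → EuclideanSpace ℂ Γ} (hb : Orthonormal ℂ b) :
    ∑ i, ‖convolutionOperator K (b i)‖ ^ 2 ≤ Fintype.card Γ * ∑ z, K z ^ 2 := by
  let k : Γ → EuclideanSpace ℂ Γ := fun x => WithLp.toLp 2 fun y => (K (x * y⁻¹) : ℂ)
  have hk : ∀ x f, convolutionOperator K f x = inner ℂ (k x) f := by
    intro x f
    simp [k, PiLp.inner_apply, mul_comm]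
  calc ∑ i, ‖convolutionOperator K (b i)‖ ^ 2
      = ∑ x, ∑ i, ‖inner ℂ (b i) (k x)‖ ^ 2 := by
        rw [Finset.sum_comm]
        refine Finset.sum_congr rfl fun i _ => ?_
        rw [EuclideanSpace.norm_sq_eq]
        exact Finset.sum_congr rfl fun x _ => by rw [hk, norm_inner_symm]
    _ ≤ ∑ x, ‖k x‖ ^ 2 := Finset.sum_le_sum fun x _ => hb.sum_inner_products_le (k x)
    _ = ∑ _x : Γ, ∑ z, K z ^ 2 := by
        refine Finset.sum_congr rfl fun x _ => ?_
        rw [EuclideanSpace.norm_sq_eq]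
        refine Fintype.sum_equiv ((Equiv.inv Γ).trans (Equiv.mulLeft x)) _ _ fun y => ?_
        simp [k]
    _ = Fintype.card Γ * ∑ z, K z ^ 2 := by simp

/-- A convolution operator that kills the constants has small norm on a group of large minimal
degree, since the top eigenspace of `T* T` is invariant under right translation and contains no
nonzero constant, hence has large multiplicity. -/
theorem norm_convolutionOperator_sq_le {D : ℝ} (hD : 0 < D) (hΓ : HasMinDegree D Γ) {K : Γ → ℝ}
    (hK : ∑ z, K z = 0) (f : EuclideanSpace ℂ Γ) :
    D * ‖convolutionOperator K f‖ ^ 2 ≤ Fintype.card Γ * (∑ z, K z ^ 2) * ‖f‖ ^ 2 := by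
  set T := convolutionOperator K with hT
  set H : Module.End ℂ (EuclideanSpace ℂ Γ) := T.adjoint ∘ₗ T with hH
  have hHinner : ∀ h, RCLike.re (inner ℂ (H h) h) = ‖T h‖ ^ 2 := by
    intro h
    rw [hH, LinearMap.comp_apply, LinearMap.adjoint_inner_left, inner_self_eq_norm_sq]
  have hHR : ∀ g h, H (rightRegular g h) = rightRegular g (H h) := by
    intro g h
    rw [hH, LinearMap.comp_apply, convolutionOperator_rightRegular,
      adjoint_convolutionOperator_rightRegular, LinearMap.comp_apply]
  have hsymm : H.IsSymmetric := LinearMap.isSymmetric_adjoint_mul_self T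
  have hev := hsymm.hasEigenvalue_iSup_of_finiteDimensional
  set l : ℝ := ⨆ x : {x : EuclideanSpace ℂ Γ // x ≠ 0},
    RCLike.re (inner ℂ (H x) (x : EuclideanSpace ℂ Γ)) / ‖(x : EuclideanSpace ℂ Γ)‖ ^ 2 with hl
  have hbdd : BddAbove (Set.range fun x : {x : EuclideanSpace ℂ Γ // x ≠ 0} =>
      RCLike.re (inner ℂ (H x) (x : EuclideanSpace ℂ Γ)) /
        ‖(x : EuclideanSpace ℂ Γ)‖ ^ 2) := by
    refine ⟨‖LinearMap.toContinuousLinearMap T‖ ^ 2, ?_⟩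
    rintro _ ⟨⟨x, hx⟩, rfl⟩
    have hx' : 0 < ‖x‖ := norm_pos_iff.2 hx
    simp only [hHinner]
    rw [div_le_iff₀ (by positivity), ← mul_pow]
    gcongr
    exact (LinearMap.toContinuousLinearMap T).le_opNorm x
  have hle : ∀ h, ‖T h‖ ^ 2 ≤ l * ‖h‖ ^ 2 := by
    intro h
    by_cases hh : h = 0
    · simp [hh]
    · have hh' : 0 < ‖h‖ := norm_pos_iff.2 hh
      rw [← div_le_iff₀ (by positivity), ← hHinner]
      exact le_ciSup hbdd ⟨h, hh⟩
  suffices hDl : D * l ≤ Fintype.card Γ * ∑ z, K z ^ 2 by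
    calc D * ‖T f‖ ^ 2 ≤ D * (l * ‖f‖ ^ 2) := by gcongr; exact hle f
      _ = D * l * ‖f‖ ^ 2 := by ring
      _ ≤ _ := by gcongr
  rcases le_or_gt l 0 with hl0 | hl0
  · exact (mul_nonpos_of_nonneg_of_nonpos hD.le hl0).trans (by positivity)
  let E := Module.End.eigenspace H (l : ℂ)
  have hmaps : ∀ g, ∀ h ∈ E, rightRegular g h ∈ E := by
    intro g h hh
    rw [Module.End.mem_eigenspace_iff] at hh ⊢
    rw [hHR, hh, map_smul]
  let ρ : Γ →* Module.End ℂ E :=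
    { toFun := fun g => (rightRegular g).restrict (hmaps g)
      map_one' := by ext; simp
      map_mul' := fun g h => by ext; simp }
  have hfin : D ≤ Module.finrank ℂ E := by
    refine hΓ E ρ ⟨Fintype.card Γ, Fintype.card_pos, fun g => ?_⟩ ?_
    · rw [← map_pow, pow_card_eq_one, map_one]
    · by_contra! hcon
      obtain ⟨h, hhE, hh0⟩ := hev.exists_hasEigenvector
      have hconst : ∀ x, h x = h 1 := by
        intro x
        have := congrArg (fun v : E => (v : EuclideanSpace ℂ Γ) 1)
          (LinearMap.congr_fun (hcon x) ⟨h, hhE⟩)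
        simpa [ρ] using this
      have hTh : T h = 0 := by
        ext x
        rw [hT, convolutionOperator_apply]
        simp only [hconst]
        rw [← Finset.sum_mul, ← Complex.ofReal_sum]
        have : ∑ y, K (x * y⁻¹) = ∑ z, K z :=
          Fintype.sum_equiv ((Equiv.inv Γ).trans (Equiv.mulLeft x)) _ _ fun y => by simp
        simp [this, hK]
      have hHh := Module.End.mem_eigenspace_iff.1 hhE
      rw [hH, LinearMap.comp_apply, hTh, map_zero, eq_comm, smul_eq_zero] at hHh
      rcases hHh with h0 | h0
      · exact hl0.ne' (RCLike.ofReal_eq_zero.1 h0)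
      · exact hh0 h0
  let b := stdOrthonormalBasis ℂ E
  have hb : Orthonormal ℂ fun i => (b i : EuclideanSpace ℂ Γ) :=
    b.orthonormal.comp_linearIsometry E.subtypeₗᵢ
  have hTb : ∀ i, ‖T (b i)‖ ^ 2 = l := by
    intro i
    rw [← hHinner, Module.End.mem_eigenspace_iff.1 (b i).2, inner_smul_left]
    have h1 : ‖(b i : EuclideanSpace ℂ Γ)‖ = 1 := hb.1 i
    simp [inner_self_eq_norm_sq_to_K, h1]
  calc D * l ≤ Module.finrank ℂ E * l := by gcongr
    _ = ∑ i, ‖T (b i)‖ ^ 2 := by simp [hTb]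
    _ ≤ _ := sum_norm_convolutionOperator_sq_le K hb

/-- In a finite group of minimal degree `D`, a product-free set has density at most
`D ^ (-1 / 3)`. -/
theorem card_productFree_pow_three_mul_le {D : ℝ} (hD : 0 < D) (hΓ : HasMinDegree D Γ)
    (S : Finset Γ) (hS : ∀ a ∈ S, ∀ b ∈ S, a * b ∉ S) :
    (S.card : ℝ) ^ 3 * D ≤ (Fintype.card Γ : ℝ) ^ 3 := by
  classical
  set n : ℝ := (Fintype.card Γ : ℝ) with hn
  set s : ℝ := (S.card : ℝ) with hs
  have hnpos : 0 < n := by rw [hn]; exact_mod_cast Fintype.card_pos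
  rcases S.eq_empty_or_nonempty with rfl | hne
  · simp only [Finset.card_empty, Nat.cast_zero] at hs
    rw [hs]
    simp only [ne_eq, OfNat.ofNat_ne_zero, not_false_eq_true, zero_pow, zero_mul]
    positivity
  have hspos : 0 < s := by rw [hs]; exact_mod_cast hne.card_pos
  let i : Γ → ℝ := fun x => if x ∈ S then 1 else 0
  let K : Γ → ℝ := fun x => i x - s / n
  have hi : ∑ x, i x = s := by simp [i, hs]
  have hK : ∑ z, K z = 0 := by
    simp only [K, Finset.sum_sub_distrib, hi]
    simp only [Finset.sum_const, Finset.card_univ, nsmul_eq_mul, ← hn]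
    field_simp
    ring
  have hK2 : ∑ z, K z ^ 2 ≤ s := by
    have : ∀ z, K z ^ 2 = i z - 2 * (s / n) * i z + (s / n) ^ 2 := by
      intro z
      simp only [K, i]
      split_ifs <;> ring
    simp only [this, Finset.sum_add_distrib, Finset.sum_sub_distrib, ← Finset.mul_sum, hi]
    simp only [Finset.sum_const, Finset.card_univ, nsmul_eq_mul, ← hn]
    have : s - 2 * (s / n) * s + n * (s / n) ^ 2 = s - s ^ 2 / n := by field_simp; ring
    rw [this]
    have : 0 ≤ s ^ 2 / n := by positivity
    linarith
  let f : EuclideanSpace ℂ Γ := WithLp.toLp 2 fun x => (i x : ℂ)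
  have hf : ‖f‖ ^ 2 = s := by
    rw [EuclideanSpace.norm_sq_eq, ← hi]
    refine Finset.sum_congr rfl fun x _ => ?_
    simp only [f, i]
    split_ifs <;> simp
  -- Since `S` is product-free, `⟪i * i, i⟫ = 0`, so only the correction term contributes.
  have hinner : inner ℂ f (convolutionOperator K f) = ((-(s ^ 3 / n) : ℝ) : ℂ) := by
    have h1 : inner ℂ f (convolutionOperator K f) =
        ((∑ x, ∑ y, i x * K (x * y⁻¹) * i y : ℝ) : ℂ) := by
      simp only [PiLp.inner_apply, convolutionOperator_apply, f]
      push_cast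
      refine Finset.sum_congr rfl fun x _ => ?_
      simp only [RCLike.inner_apply, Complex.conj_ofReal, Finset.sum_mul]
      exact Finset.sum_congr rfl fun y _ => by ring
    have h2 : ∀ x y, i x * K (x * y⁻¹) * i y = -(s / n) * (i x * i y) := by
      intro x y
      have h3 : i x * i (x * y⁻¹) * i y = 0 := by
        simp only [i]
        by_cases hx : x ∈ S <;> by_cases hy : y ∈ S <;> by_cases hxy : x * y⁻¹ ∈ S <;>
          simp only [hx, hy, hxy, if_true, if_false, mul_zero, mul_one]
        exact absurd (by simpa using hx) (hS _ hxy _ hy)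
      simp only [K]
      linear_combination h3
    rw [h1]
    congr 1
    simp only [h2, ← Finset.mul_sum, hi, ← Finset.sum_mul]
    ring
  have hcs : s ^ 3 / n ≤ ‖f‖ * ‖convolutionOperator K f‖ := by
    have := norm_inner_le_norm (𝕜 := ℂ) f (convolutionOperator K f)
    rw [hinner, Complex.norm_real, norm_neg, Real.norm_of_nonneg (by positivity)] at this
    exact this
  have hop := norm_convolutionOperator_sq_le hD hΓ hK f
  rw [← hn, hf] at hop
  have hsq : (s ^ 3 / n) ^ 2 ≤ s * ‖convolutionOperator K f‖ ^ 2 := by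
    calc (s ^ 3 / n) ^ 2 ≤ (‖f‖ * ‖convolutionOperator K f‖) ^ 2 := by gcongr
      _ = s * ‖convolutionOperator K f‖ ^ 2 := by rw [mul_pow, hf]
  have hfinal : D * (s ^ 3 / n) ^ 2 ≤ n * s ^ 3 := by
    calc D * (s ^ 3 / n) ^ 2 ≤ D * (s * ‖convolutionOperator K f‖ ^ 2) := by gcongr
      _ = s * (D * ‖convolutionOperator K f‖ ^ 2) := by ring
      _ ≤ s * (n * (∑ z, K z ^ 2) * s) := by gcongr
      _ ≤ s * (n * s * s) := by gcongr
      _ = n * s ^ 3 := by ring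
  rw [div_pow, mul_div_assoc', div_le_iff₀ (by positivity)] at hfinal
  have h6 : s ^ 3 * (s ^ 3 * D) ≤ s ^ 3 * n ^ 3 := by
    calc s ^ 3 * (s ^ 3 * D) = D * (s ^ 3) ^ 2 := by ring
      _ ≤ n * s ^ 3 * n ^ 2 := hfinal
      _ = s ^ 3 * n ^ 3 := by ring
  exact le_of_mul_le_mul_left h6 (by positivity)

end FiniteGroup

/-! ### Product-free sets in compact groups -/

section CompactGroup

variable {G : Type u} [Group G] [TopologicalSpace G] [IsTopologicalGroup G] [CompactSpace G]

theorem index_mul_normalizedHaar (H : Subgroup G) [H.FiniteIndex]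
    (hH : MeasurableSet[borel G] (H : Set G)) : H.index * normalizedHaar G H = 1 := by
  let _ : MeasurableSpace G := borel G
  have _ : BorelSpace G := ⟨rfl⟩
  rw [← normalizedHaar_univ G]
  exact Subgroup.index_mul_measure H hH (Measure.haarMeasure ⊤)

theorem normalizedHaar_smul (g : G) (A : Set G) :
    normalizedHaar G (g • A) = normalizedHaar G A := by
  let _ : MeasurableSpace G := borel G
  have _ : BorelSpace G := ⟨rfl⟩
  exact measure_smul (Measure.haarMeasure ⊤) g A

/-- A nontrivial coset of a subgroup is product-free. -/
theorem one_div_le_productFreeMeasure (H : Subgroup G) [H.FiniteIndex]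
    (hH : MeasurableSet[borel G] (H : Set G)) (hne : H ≠ ⊤) {n : ℕ} (hn : H.index ≤ n) :
    1 / (n : ℝ) ≤ productFreeMeasure G := by
  obtain ⟨g, hg⟩ : ∃ g, g ∉ H := by
    by_contra! h
    exact hne ((Subgroup.eq_top_iff' H).2 h)
  have hpos : 0 < H.index := Nat.pos_of_ne_zero Subgroup.FiniteIndex.index_ne_zero
  have hμ : (normalizedHaar G (g • (H : Set G))).toReal = 1 / H.index := by
    have h := congrArg ENNReal.toReal (index_mul_normalizedHaar H hH)
    rw [ENNReal.toReal_mul, ENNReal.toReal_natCast, ENNReal.toReal_one] at h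
    rw [normalizedHaar_smul, eq_div_iff (by positivity), mul_comm, h]
  have hmem : 1 / (H.index : ℝ) ∈ productFreeMeasures G := by
    refine ⟨g • (H : Set G), ?_, ?_, hμ.symm⟩
    · let _ : MeasurableSpace G := borel G
      have _ : BorelSpace G := ⟨rfl⟩
      exact MeasurableSet.const_smul hH g
    · refine Set.eq_empty_of_forall_notMem fun x hx => hg ?_
      obtain ⟨⟨a, ha, rfl⟩, _, ⟨b, hb, rfl⟩, _, ⟨c, hc, rfl⟩, habc⟩ := hx
      simp only [smul_eq_mul, SetLike.mem_coe] at ha hb hc habc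
      have : b * g * c = a := by
        rw [← mul_right_inj g, ← habc]
        group
      rw [show g = b⁻¹ * a * c⁻¹ by rw [← this]; group]
      exact H.mul_mem (H.mul_mem (H.inv_mem hb) ha) (H.inv_mem hc)
  refine le_trans ?_ ((isLUB_productFreeMeasure G).1 hmem)
  have : (H.index : ℝ) ≤ n := by exact_mod_cast hn
  gcongr

/-- A compact product-free set in a profinite group remains product-free modulo some open normal
subgroup. -/
theorem exists_openNormalSubgroup_image_productFree [T2Space G] [TotallyDisconnectedSpace G]
    {K : Set G} (hK : IsCompact K) (hfree : K ∩ (K * K) = ∅) :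
    ∃ N : OpenNormalSubgroup G, ∀ a ∈ K, ∀ b ∈ K, ∀ c ∈ K,
      (QuotientGroup.mk a * QuotientGroup.mk b : G ⧸ N.toSubgroup) ≠ QuotientGroup.mk c := by
  obtain ⟨V, hV, hKV⟩ := compact_open_separated_mul_right (hK.mul hK) hK.isClosed.isOpen_compl
    (fun x hx hx' => by
      have : x ∈ K ∩ (K * K) := ⟨hx', hx⟩
      simp [hfree] at this)
  obtain ⟨W, hWV, hWo, hW1⟩ := mem_nhds_iff.1 hV
  obtain ⟨N, hN⟩ := ProfiniteGrp.exist_openNormalSubgroup_sub_open_nhds_of_one hWo hW1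
  refine ⟨N, fun a ha b hb c hc habc => ?_⟩
  rw [← QuotientGroup.mk_mul, QuotientGroup.eq] at habc
  refine hKV ⟨a * b, Set.mul_mem_mul ha hb, (a * b)⁻¹ * c, hWV (hN habc), ?_⟩ hc
  exact mul_inv_cancel_left _ _

/-- Gowers' bound for profinite groups. By inner regularity it suffices to bound the measure of a
compact product-free set, and such a set is product-free already in some finite quotient. -/
theorem productFreeMeasure_le [T2Space G] [TotallyDisconnectedSpace G] {D : ℝ} (hD : 0 < D)
    (hG : HasMinDegree D G) : productFreeMeasure G ≤ D ^ (-(1 / 3) : ℝ) := by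
  refine (isLUB_productFreeMeasure G).2 ?_
  rintro _ ⟨A, hA, hfree, rfl⟩
  let _ : MeasurableSpace G := borel G
  have _ : BorelSpace G := ⟨rfl⟩
  have hreg : (normalizedHaar G).Regular :=
    inferInstanceAs (Measure.haarMeasure (⊤ : TopologicalSpace.PositiveCompacts G)).Regular
  have hfin : normalizedHaar G A ≠ ⊤ :=
    ((measure_mono (Set.subset_univ A)).trans_lt (by simp [normalizedHaar_univ])).ne
  refine ENNReal.toReal_le_of_le_ofReal (by positivity) ?_
  refine le_of_forall_lt fun r hr => ?_
  obtain ⟨K, hKA, hK, hrK⟩ := hA.exists_lt_isCompact_of_ne_top hfin hr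
  refine hrK.trans_le ?_
  have hKfree : K ∩ (K * K) = ∅ :=
    Set.subset_empty_iff.1 ((Set.inter_subset_inter hKA (Set.mul_subset_mul hKA hKA)).trans
      hfree.subset)
  obtain ⟨N, hN⟩ := exists_openNormalSubgroup_image_productFree hK hKfree
  let Γ := G ⧸ N.toSubgroup
  have : Finite Γ := N.toSubgroup.quotient_finite_of_isOpen N.isOpen'
  have : Fintype Γ := Fintype.ofFinite Γ
  have : N.toSubgroup.FiniteIndex := Subgroup.finiteIndex_of_finite_quotient
  classical
  let S : Finset Γ := Finset.univ.filter fun x => ∃ a ∈ K, (QuotientGroup.mk a : Γ) = x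
  have hS : ∀ a ∈ S, ∀ b ∈ S, a * b ∉ S := by
    intro a ha b hb hc
    simp only [S, Finset.mem_filter, Finset.mem_univ, true_and] at ha hb hc
    obtain ⟨a, ha, rfl⟩ := ha
    obtain ⟨b, hb, rfl⟩ := hb
    obtain ⟨c, hc, hc'⟩ := hc
    exact hN a ha b hb c hc hc'.symm
  have hcard := card_productFree_pow_three_mul_le hD
    (hG.of_surjective (QuotientGroup.mk' N.toSubgroup) (QuotientGroup.mk'_surjective _)) S hS
  have hcover : K ⊆ ⋃ x ∈ S, (Quotient.out x : G) • (N.toSubgroup : Set G) := by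
    intro a ha
    have haS : (QuotientGroup.mk a : Γ) ∈ S := by
      simp only [S, Finset.mem_filter, Finset.mem_univ, true_and]
      exact ⟨a, ha, rfl⟩
    refine Set.mem_biUnion haS ?_
    rw [Set.mem_smul_set_iff_inv_smul_mem, smul_eq_mul, SetLike.mem_coe, ← QuotientGroup.eq]
    exact Quotient.out_eq _
  have hμN : normalizedHaar G (N.toSubgroup : Set G) = ENNReal.ofReal (1 / Fintype.card Γ) := by
    have h := index_mul_normalizedHaar N.toSubgroup N.isOpen'.measurableSet
    rw [Subgroup.index, Nat.card_eq_fintype_card] at h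
    rw [one_div, ENNReal.ofReal_inv_of_pos (by exact_mod_cast Fintype.card_pos),
      ENNReal.ofReal_natCast]
    exact ENNReal.eq_inv_of_mul_eq_one_left (by rw [mul_comm]; exact h)
  have hμK : normalizedHaar G K ≤ ENNReal.ofReal (S.card / Fintype.card Γ) := by
    calc normalizedHaar G K
        ≤ ∑ x ∈ S, normalizedHaar G ((Quotient.out x : G) • (N.toSubgroup : Set G)) :=
          (measure_mono hcover).trans (measure_biUnion_finset_le _ _)
      _ = ENNReal.ofReal (S.card / Fintype.card Γ) := by
        simp only [normalizedHaar_smul, hμN, Finset.sum_const, nsmul_eq_mul]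
        rw [← ENNReal.ofReal_natCast, ← ENNReal.ofReal_mul (by positivity), mul_one_div]
  refine hμK.trans (ENNReal.ofReal_le_ofReal ?_)
  have hn : 0 < (Fintype.card Γ : ℝ) := by exact_mod_cast Fintype.card_pos
  have h3 : ((S.card : ℝ) / Fintype.card Γ) ^ 3 ≤ D⁻¹ := by
    rw [div_pow, div_le_iff₀ (by positivity), ← div_eq_inv_mul, le_div_iff₀ hD]
    exact hcard
  rw [Real.rpow_neg hD.le, ← Real.inv_rpow hD.le]
  rw [one_div, Real.le_rpow_inv_iff_of_pos (by positivity) (by positivity) (by norm_num)]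
  exact_mod_cast h3

end CompactGroup

/-! ### Stabilizers of lines modulo `p` -/

section Line

variable {p : ℕ} [Fact p.Prime]

theorem PadicInt.toZMod_eq_zero_iff (x : ℤ_[p]) : PadicInt.toZMod x = 0 ↔ ‖x‖ < 1 := by
  rw [← RingHom.mem_ker, PadicInt.ker_toZMod, IsLocalRing.mem_maximalIdeal, PadicInt.mem_nonunits]

/-- A group mapping to `SL ι ℤ_[p]` acts on the projective space over `ZMod p`; if it moves a
coordinate line, then the stabilizer of that line is a proper subgroup whose index is at most the
number of points. -/
theorem div_le_productFreeMeasure_of_hom {G : Type*} [Group G] [TopologicalSpace G]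
    [IsTopologicalGroup G] [CompactSpace G] {ι : Type*} [Fintype ι] [DecidableEq ι]
    (f : G →* Matrix.SpecialLinearGroup ι ℤ_[p]) (hf : ∀ i j, Continuous fun g => f g i j)
    {i₀ i₁ : ι} (hi : i₁ ≠ i₀) (g₁ : G) (hg₁ : ‖f g₁ i₁ i₀‖ = 1) :
    ((p : ℝ) - 1) / ((p : ℝ) ^ Fintype.card ι - 1) ≤ productFreeMeasure G := by
  let f' : G →* Matrix.SpecialLinearGroup ι (ZMod p) :=
    (Matrix.SpecialLinearGroup.map PadicInt.toZMod).comp f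
  let e : ι → ZMod p := Pi.single i₀ 1
  have he : e ≠ 0 := by simp [e]
  let x : Projectivization (ZMod p) (ι → ZMod p) := Projectivization.mk (ZMod p) e he
  let _ : MulAction G (Projectivization (ZMod p) (ι → ZMod p)) := MulAction.compHom _ f'
  let H : Subgroup G := MulAction.stabilizer G x
  have hsmul : ∀ g i, (f' g • e) i = PadicInt.toZMod (f g i i₀) := by
    intro g i
    simp [f', e, Matrix.SpecialLinearGroup.smul_def]
  have hmem : ∀ g, g ∈ H ↔ ∀ i, i ≠ i₀ → ‖f g i i₀‖ < 1 := by
    intro g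
    have h1 : g ∈ H ↔ f' g • x = x := Iff.rfl
    rw [h1, Projectivization.smul_mk, Projectivization.mk_eq_mk_iff']
    constructor
    · rintro ⟨a, ha⟩ i hi
      rw [← PadicInt.toZMod_eq_zero_iff, ← hsmul, ← ha]
      simp [e, hi]
    · intro h
      refine ⟨PadicInt.toZMod (f g i₀ i₀), ?_⟩
      ext i
      rw [hsmul]
      by_cases hi : i = i₀
      · subst hi
        simp [e]
      · rw [(PadicInt.toZMod_eq_zero_iff _).2 (h i hi)]
        simp [e, hi]
  have hindex : H.index ≤ Nat.card (Projectivization (ZMod p) (ι → ZMod p)) := by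
    rw [MulAction.index_stabilizer, ← Set.ncard_univ]
    exact Set.ncard_le_ncard (Set.subset_univ _)
  have : H.FiniteIndex := by
    refine ⟨?_⟩
    rw [MulAction.index_stabilizer, Ne, Set.ncard_eq_zero]
    exact (MulAction.nonempty_orbit x).ne_empty
  have hopen : IsOpen (H : Set G) := by
    have : (H : Set G) = ⋂ i ∈ {i | i ≠ i₀}, {g | ‖f g i i₀‖ < 1} := by
      ext g
      simp [hmem]
    rw [this]
    exact (Set.toFinite _).isOpen_biInter fun i _ =>
      isOpen_lt (continuous_norm.comp (hf i i₀)) continuous_const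
  have hmeas : MeasurableSet[borel G] (H : Set G) := by
    let _ : MeasurableSpace G := borel G
    have _ : BorelSpace G := ⟨rfl⟩
    exact hopen.measurableSet
  have hne : H ≠ ⊤ := by
    intro h
    have := (hmem g₁).1 (h ▸ Subgroup.mem_top g₁) i₁ hi
    exact this.ne hg₁
  refine le_trans (le_of_eq ?_) (one_div_le_productFreeMeasure H hmeas hne hindex)
  have hp : (1 : ℝ) < p := by exact_mod_cast (Fact.out : p.Prime).one_lt
  have hcard := Projectivization.card' (ZMod p) (ι → ZMod p)
  rw [Nat.card_fun, Nat.card_zmod, Nat.card_eq_fintype_card (α := ι)] at hcard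
  have hcard' : (p : ℝ) ^ Fintype.card ι - 1 =
      Nat.card (Projectivization (ZMod p) (ι → ZMod p)) * ((p : ℝ) - 1) := by
    have h := congrArg (Nat.cast (R := ℝ)) hcard
    push_cast [Nat.cast_sub (Fact.out : p.Prime).one_lt.le] at h
    rw [h]
    ring
  rw [hcard']
  have : (p : ℝ) - 1 ≠ 0 := by linarith
  have : (Nat.card (Projectivization (ZMod p) (ι → ZMod p)) : ℝ) ≠ 0 := by
    have := hindex
    have h0 : H.index ≠ 0 := Subgroup.FiniteIndex.index_ne_zero
    exact_mod_cast (by omega : Nat.card (Projectivization (ZMod p) (ι → ZMod p)) ≠ 0)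
  field_simp

end Line

/-! ### Elementary matrices in the special linear group -/

section SpecialLinear

open Matrix

variable {n R : Type*} [Fintype n] [DecidableEq n] [CommRing R]

theorem Matrix.det_one_add_vecMulVec_of_dotProduct_eq_zero {u v : n → R} (h : v ⬝ᵥ u = 0) :
    (1 + vecMulVec u v).det = 1 := by
  rw [vecMulVec_eq Unit, det_one_add_replicateCol_mul_replicateRow, h, add_zero]

namespace Matrix.SpecialLinearGroup

/-- The transvection `1 + u vᵀ` along a vector `u` in the kernel of the linear form `v`. -/
def vecTransvection (u v : n → R) (h : v ⬝ᵥ u = 0) : SpecialLinearGroup n R :=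
  ⟨1 + vecMulVec u v, det_one_add_vecMulVec_of_dotProduct_eq_zero h⟩

theorem coe_vecTransvection (u v : n → R) (h : v ⬝ᵥ u = 0) :
    (vecTransvection u v h : Matrix n n R) = 1 + vecMulVec u v := rfl

theorem vecTransvection_mul_right (u v w : n → R) (hv : v ⬝ᵥ u = 0) (hw : w ⬝ᵥ u = 0)
    (hvw : (v + w) ⬝ᵥ u = 0) :
    vecTransvection u (v + w) hvw = vecTransvection u v hv * vecTransvection u w hw := by
  apply Subtype.ext
  rw [coe_mul, coe_vecTransvection, coe_vecTransvection, coe_vecTransvection, add_mul, mul_add,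
    mul_add, vecMulVec_mul_vecMulVec, hv, vecMulVec_add]
  simp [add_assoc, add_comm]

theorem vecTransvection_mul_left (u v w : n → R) (hu : v ⬝ᵥ u = 0) (hw : v ⬝ᵥ w = 0)
    (huw : v ⬝ᵥ (u + w) = 0) :
    vecTransvection (u + w) v huw = vecTransvection u v hu * vecTransvection w v hw := by
  apply Subtype.ext
  rw [coe_mul, coe_vecTransvection, coe_vecTransvection, coe_vecTransvection, add_mul, mul_add,
    mul_add, vecMulVec_mul_vecMulVec, hw, add_vecMulVec]
  simp [add_assoc, add_comm]

theorem vecTransvection_single {i j : n} (hij : i ≠ j) (a b : R)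
    (h : Pi.single j b ⬝ᵥ Pi.single i a = 0) :
    vecTransvection (Pi.single i a) (Pi.single j b) h = transvection hij (a * b) := by
  apply Subtype.ext
  rw [coe_vecTransvection, transvection_coe]
  congr 1
  ext k l
  simp only [vecMulVec_apply, single_apply, Pi.single_apply]
  by_cases h1 : i = k <;> by_cases h2 : j = l <;> simp [h1, h2, eq_comm]

variable {N : Subgroup (SpecialLinearGroup n R)}

theorem vecTransvection_single_right_mem
    (hN : ∀ (i j : n) (hij : i ≠ j) (c : R), transvection hij c ∈ N) {j : n} {x : n → R}
    (hx : x j = 0) (h : Pi.single j 1 ⬝ᵥ x = 0) : vecTransvection x (Pi.single j 1) h ∈ N := by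
  suffices H : ∀ (t : Finset n) (h : Pi.single j 1 ⬝ᵥ (∑ i ∈ t, Pi.single i (x i)) = 0),
      vecTransvection (∑ i ∈ t, Pi.single i (x i)) (Pi.single j 1) h ∈ N by
    have := H Finset.univ (by rwa [Finset.univ_sum_single x])
    simpa only [Finset.univ_sum_single x] using this
  intro t
  induction t using Finset.induction_on with
  | empty =>
    intro h
    convert N.one_mem
    apply Subtype.ext
    simp [coe_vecTransvection]
  | insert i t hi ih =>
    have ht : Pi.single j 1 ⬝ᵥ (∑ i ∈ t, Pi.single i (x i)) = 0 := by
      rw [single_one_dotProduct, Finset.sum_apply]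
      refine Finset.sum_eq_zero fun l _ => ?_
      by_cases hl : j = l
      · subst hl
        simp [hx]
      · simp [hl]
    have hi' : Pi.single j 1 ⬝ᵥ (Pi.single i (x i) : n → R) = 0 := by
      by_cases hl : j = i
      · subst hl
        simp [hx]
      · simp [hl]
    intro h
    simp only [Finset.sum_insert hi]
    rw [vecTransvection_mul_left _ _ _ hi' ht]
    refine N.mul_mem ?_ (ih ht)
    by_cases hl : i = j
    · subst hl
      convert N.one_mem
      apply Subtype.ext
      simp [coe_vecTransvection, hx]
    · rw [vecTransvection_single hl]
      exact hN _ _ _ _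

theorem transvection_mul_apply {i j : n} (hij : i ≠ j) (c : R) (g : SpecialLinearGroup n R)
    (k l : n) : (transvection hij c * g) k l = g k l + if k = i then c * g j l else 0 := by
  change (Matrix.transvection i j c * (g : Matrix n n R)) k l = _
  split_ifs with h
  · subst h
    rw [transvection_mul_apply_same]
  · rw [transvection_mul_apply_of_ne _ _ _ _ h, add_zero]

/-- One step of Gaussian elimination over a local ring: if the columns of `g` in `s` are standard,
then row operations make one more column standard. -/
theorem exists_mem_mul_standard_insert [IsLocalRing R]
    (hN : ∀ (i j : n) (hij : i ≠ j) (c : R), transvection hij c ∈ N) (s : Finset n)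
    (g : SpecialLinearGroup n R) (hg : ∀ l ∈ s, ∀ i, g i l = (1 : Matrix n n R) i l) {j : n}
    (hj : j ∉ s) : ∃ e ∈ N, ∀ l ∈ insert j s, ∀ i, (e * g) i l = (1 : Matrix n n R) i l := by
  -- It is enough to make the diagonal entry equal to `1`.
  suffices H : ∃ e ∈ N, (∀ l ∈ s, ∀ i, (e * g) i l = (1 : Matrix n n R) i l) ∧
      (e * g) j j = 1 by
    obtain ⟨e, he, hes, hej⟩ := H
    set g' := e * g with hg'
    let x : n → R := Function.update (fun i => -g' i j) j 0
    have hx : x j = 0 := by simp [x]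
    have hx' : Pi.single j 1 ⬝ᵥ x = 0 := by simp [hx]
    refine ⟨vecTransvection x (Pi.single j 1) hx' * e,
      N.mul_mem (vecTransvection_single_right_mem hN hx hx') he, ?_⟩
    have hmul : ∀ i l, (vecTransvection x (Pi.single j 1) hx' * e * g) i l =
        g' i l + x i * g' j l := by
      intro i l
      rw [mul_assoc, ← hg', coe_mul, coe_vecTransvection, add_mul, vecMulVec_mul, one_mul,
        single_one_vecMul]
      rfl
    intro l hl i
    rw [hmul]
    rcases Finset.mem_insert.1 hl with rfl | hl
    · rw [hej]
      by_cases hi : i = l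
      · subst hi
        simp [hx, hej]
      · simp [x, hi]
    · have hjl : j ≠ l := fun h => hj (h ▸ hl)
      rw [hes l hl i, hes l hl j, one_apply_ne hjl, mul_zero, add_zero]
  have hrow : ∀ (e : SpecialLinearGroup n R), (∀ l ∈ s, ∀ i, (e * g) i l = (1 : Matrix n n R) i l) →
      ∀ (a b : n) (hab : a ≠ b) (c : R), b ∉ s →
      ∀ l ∈ s, ∀ i, (transvection hab c * e * g) i l = (1 : Matrix n n R) i l := by
    intro e he a b hab c hb l hl i
    have hbl : b ≠ l := fun h => hb (h ▸ hl)
    rw [mul_assoc, transvection_mul_apply, he l hl, he l hl, one_apply_ne hbl]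
    simp
  by_cases hlast : ∀ i, i ∉ s → i = j
  · -- All other columns are standard, so the diagonal entry is the determinant.
    refine ⟨1, N.one_mem, by simpa using hg, ?_⟩
    have hupd : (g : Matrix n n R) = (1 : Matrix n n R).updateCol j fun i => g i j := by
      ext i l
      by_cases hl : l = j
      · subst hl
        simp
      · rw [updateCol_ne hl]
        exact hg l (by by_contra h; exact hl (hlast l h)) i
    have hdet := g.det_coe
    rw [hupd, ← cramer_apply, cramer_one] at hdet
    simpa using hdet
  · push Not at hlast
    obtain ⟨i', hi's, hi'j⟩ := hlast
    -- Some entry off the diagonal and outside the rows in `s` can be made a unit.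
    have hunit : ∃ e ∈ N, (∀ l ∈ s, ∀ i, (e * g) i l = (1 : Matrix n n R) i l) ∧
        ∃ i, i ∉ s ∧ i ≠ j ∧ IsUnit ((e * g) i j) := by
      have hinv : ∀ l ∈ s, (g⁻¹ : SpecialLinearGroup n R) j l = 0 := by
        intro l hl
        have h1 : ((g⁻¹ * g : SpecialLinearGroup n R) : Matrix n n R) j l = 0 := by
          rw [inv_mul_cancel, coe_one, one_apply_ne]
          exact fun h => hj (h ▸ hl)
        rw [coe_mul, mul_apply] at h1
        simpa [hg l hl, one_apply] using h1
      have hsum : ∑ i, (g⁻¹ : SpecialLinearGroup n R) j i * g i j = 1 := by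
        have h1 : ((g⁻¹ * g : SpecialLinearGroup n R) : Matrix n n R) j j = 1 := by
          rw [inv_mul_cancel, coe_one, one_apply_eq]
        rwa [coe_mul, mul_apply] at h1
      obtain ⟨i, hi⟩ : ∃ i, IsUnit ((g⁻¹ : SpecialLinearGroup n R) j i * g i j) := by
        by_contra! hcon
        have : ∑ i, (g⁻¹ : SpecialLinearGroup n R) j i * g i j ∈ IsLocalRing.maximalIdeal R :=
          Ideal.sum_mem _ fun i _ => (IsLocalRing.mem_maximalIdeal _).2 (hcon i)
        rw [hsum] at this
        exact (Ideal.ne_top_iff_one _).1 (IsLocalRing.maximalIdeal.isMaximal R).ne_top this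
      have his : i ∉ s := by
        intro h
        rw [hinv i h, zero_mul] at hi
        exact not_isUnit_zero hi
      have hig : IsUnit (g i j) := isUnit_of_mul_isUnit_right hi
      by_cases hij : i = j
      · subst hij
        by_cases hi'u : IsUnit (g i' i)
        · exact ⟨1, N.one_mem, by simpa using hg, i', hi's, hi'j, by simpa using hi'u⟩
        · refine ⟨transvection hi'j 1, hN _ _ _ _, ?_, i', hi's, hi'j, ?_⟩
          · simpa using hrow 1 (by simpa using hg) i' i hi'j 1 hj
          · rw [transvection_mul_apply, if_pos rfl, one_mul]
            by_contra h
            have h2 := (IsLocalRing.maximalIdeal R).sub_mem ((IsLocalRing.mem_maximalIdeal _).2 h)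
              ((IsLocalRing.mem_maximalIdeal _).2 hi'u)
            rw [add_sub_cancel_left] at h2
            exact (IsLocalRing.mem_maximalIdeal _).1 h2 hig
      · exact ⟨1, N.one_mem, by simpa using hg, i, his, hij, by simpa using hig⟩
    obtain ⟨e, he, hes, i, his, hij, hu⟩ := hunit
    obtain ⟨u, hu⟩ := hu
    refine ⟨transvection (Ne.symm hij) ((1 - (e * g) j j) * ↑u⁻¹) * e,
      N.mul_mem (hN _ _ _ _) he, hrow e hes _ _ _ _ his, ?_⟩
    rw [mul_assoc, transvection_mul_apply, if_pos rfl, ← hu, mul_assoc, Units.inv_mul]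
    ring

/-- Over a local ring the special linear group is generated by the elementary transvections. -/
theorem eq_top_of_transvection_mem [IsLocalRing R]
    (hN : ∀ (i j : n) (hij : i ≠ j) (c : R), transvection hij c ∈ N) : N = ⊤ := by
  rw [Subgroup.eq_top_iff']
  intro g
  have H : ∀ s : Finset n, ∃ e ∈ N, ∀ l ∈ s, ∀ i, (e * g) i l = (1 : Matrix n n R) i l := by
    intro s
    induction s using Finset.induction_on with
    | empty => exact ⟨1, N.one_mem, by simp⟩
    | insert j s hj ih =>
      obtain ⟨e, he, hes⟩ := ih
      obtain ⟨e', he', hes'⟩ := exists_mem_mul_standard_insert hN s (e * g) hes hj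
      exact ⟨e' * e, N.mul_mem he' he, by simpa only [mul_assoc] using hes'⟩
  obtain ⟨e, he, heg⟩ := H Finset.univ
  have h1 : e * g = 1 := by
    ext i j
    simpa using heg j (Finset.mem_univ j) i
  rw [eq_inv_of_mul_eq_one_right h1]
  exact N.inv_mem he

end Matrix.SpecialLinearGroup

end SpecialLinear

/-! ### Characters of abelian subgroups -/

section Characters

/-- Let `u` be a homomorphism from an abelian group `A` to `G` on which a representation of finite
exponent is nontrivial. Then some nontrivial character `χ` of `A` occurs in the representation, and
so do all its conjugates `χ ∘ φ a` by elements `g a` normalizing the image of `u`. Hence the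
number of distinct conjugates is a lower bound for the dimension. -/
theorem exists_addChar_card_le_finrank {V G A : Type*} [AddCommGroup V] [Module ℂ V]
    [FiniteDimensional ℂ V] [Group G] [AddCommGroup A] (ρ : G →* Module.End ℂ V)
    (hρ : ∃ m : ℕ, 0 < m ∧ ∀ g, ρ g ^ m = 1) (u : A → G) (hu : ∀ x y, u (x + y) = u x * u y)
    {x₀ : A} (hx₀ : ρ (u x₀) ≠ 1) :
    ∃ χ : AddChar A ℂ, χ x₀ ≠ 1 ∧ ∀ (κ : Type) [Fintype κ] (g : κ → G) (φ : κ → A → A),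
      (∀ a x, u x * g a = g a * u (φ a x)) → Function.Injective (fun a x => χ (φ a x)) →
      Fintype.card κ ≤ Module.finrank ℂ V := by
  obtain ⟨m, hm, hpow⟩ := hρ
  have hc : ∀ x y, Commute (ρ (u x)) (ρ (u y)) := by
    intro x y
    rw [Commute, SemiconjBy, ← map_mul, ← map_mul, ← hu, ← hu, add_comm]
  obtain ⟨χ, hχ, v, hv0, hv⟩ :=
    exists_joint_eigenvector (fun x => ρ (u x)) hc hm (fun x => hpow _) hx₀
  have hu0 : u 0 = 1 := by simpa using hu 0 0
  have hχ0 : χ 0 = 1 := by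
    have h := hv 0
    rw [hu0, map_one, Module.End.one_apply] at h
    exact smul_left_injective ℂ hv0 (by simpa using h.symm)
  have hχadd : ∀ x y, χ (x + y) = χ x * χ y := by
    intro x y
    have h := hv (x + y)
    rw [hu, map_mul, Module.End.mul_apply, hv, map_smul, hv, smul_smul] at h
    rw [mul_comm]
    exact smul_left_injective ℂ hv0 (by simpa [mul_comm] using h.symm)
  refine ⟨⟨χ, hχ0, hχadd⟩, hχ, fun κ _ g φ hg hinj => ?_⟩
  refine card_le_finrank_of_joint_eigenvectors (fun x => ρ (u x)) hc (fun a x => χ (φ a x)) hinj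
    (fun a => ρ (g a) v) (fun a ha => hv0 ?_) (fun a x => ?_)
  · have : ρ (g a)⁻¹ (ρ (g a) v) = v := by
      rw [← Module.End.mul_apply, ← map_mul, inv_mul_cancel, map_one, Module.End.one_apply]
    rw [← this, ha, map_zero]
  · rw [← Module.End.mul_apply, ← map_mul, hg, map_mul, Module.End.mul_apply, hv, map_smul]

/-- Two multiples `t ↦ ψ (t a)` and `t ↦ ψ (t b)` of a nontrivial character can only agree if
`a - b` is not a unit. -/
theorem AddChar.not_isUnit_sub {R : Type*} [CommRing R] {ψ : AddChar R ℂ} {t₀ : R}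
    (hψ : ψ t₀ ≠ 1) {a b : R} (h : ∀ t, ψ (t * a) = ψ (t * b)) : ¬IsUnit (a - b) := by
  rintro ⟨w, hw⟩
  refine hψ ?_
  have h1 : t₀ * ↑w⁻¹ * a = t₀ + t₀ * ↑w⁻¹ * b := by
    have : t₀ * ↑w⁻¹ * (a - b) = t₀ := by rw [← hw, mul_assoc, Units.inv_mul, mul_one]
    linear_combination this
  have h2 := h (t₀ * ↑w⁻¹)
  rw [h1, AddChar.map_add_eq_mul] at h2
  have h3 : ψ (t₀ * ↑w⁻¹ * b) ≠ 0 := (ψ.val_isUnit _).ne_zero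
  exact mul_right_cancel₀ h3 (by rw [h2, one_mul])

variable {p : ℕ} [Fact p.Prime]

theorem PadicInt.isUnit_natCast_of_lt {a : ℕ} (h0 : 0 < a) (ha : a < p) :
    IsUnit (a : ℤ_[p]) := by
  rw [PadicInt.isUnit_iff, PadicInt.norm_natCast_eq_one_iff]
  exact ((Fact.out : p.Prime).coprime_iff_not_dvd.2 (Nat.not_dvd_of_pos_of_lt h0 ha))

theorem PadicInt.isUnit_natCast_sub_natCast {a b : ℕ} (ha : a < p) (hb : b < p) (hab : a ≠ b) :
    IsUnit ((a : ℤ_[p]) - b) := by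
  rcases lt_or_gt_of_ne hab with h | h
  · rw [← IsUnit.neg_iff, neg_sub, ← Nat.cast_sub h.le]
    exact isUnit_natCast_of_lt (by omega) (by omega)
  · rw [← Nat.cast_sub h.le]
    exact isUnit_natCast_of_lt (by omega) (by omega)

/-- The squares of `1, …, (p - 1) / 2` are distinct modulo `p`. -/
theorem PadicInt.isUnit_sq_sub_sq {a b : ℕ} (ha : a < (p - 1) / 2) (hb : b < (p - 1) / 2)
    (hab : a ≠ b) : IsUnit (((a + 1 : ℕ) : ℤ_[p]) ^ 2 - ((b + 1 : ℕ) : ℤ_[p]) ^ 2) := by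
  rw [sq_sub_sq, ← Nat.cast_add]
  exact (isUnit_natCast_of_lt (by omega) (by omega)).mul
    (isUnit_natCast_sub_natCast (by omega) (by omega) (by omega))

end Characters

/-! ### The minimal degree of the special linear group -/

section SpecialLinearDegree

open Matrix Matrix.SpecialLinearGroup

namespace Matrix.SpecialLinearGroup

variable {n R : Type*} [Fintype n] [DecidableEq n] [CommRing R]

/-- The diagonal matrix with entries `a` and `a⁻¹` in positions `i ≠ j`. -/
def diagPair {i j : n} (hij : i ≠ j) (a : Rˣ) : SpecialLinearGroup n R :=
  ⟨diagonal fun l => if l = i then (a : R) else if l = j then ↑a⁻¹ else 1, by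
    rw [det_diagonal, ← Finset.mul_prod_erase _ _ (Finset.mem_univ i),
      ← Finset.mul_prod_erase _ _ (Finset.mem_erase.2 ⟨hij.symm, Finset.mem_univ j⟩)]
    rw [Finset.prod_eq_one]
    · simp [hij.symm]
    · intro l hl
      simp only [Finset.mem_erase, Finset.mem_univ, and_true] at hl
      simp [hl.1, hl.2]⟩

theorem coe_diagPair {i j : n} (hij : i ≠ j) (a : Rˣ) : (diagPair hij a : Matrix n n R) =
    diagonal fun l => if l = i then (a : R) else if l = j then ↑a⁻¹ else 1 := rfl

/-- The matrix `1 + e_i xᵀ` for a vector `x` with `x i = 0`; these form an abelian group. -/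
def rowTransvection (i : n) (x : LinearMap.ker (LinearMap.proj (R := R) (φ := fun _ : n => R) i)) :
    SpecialLinearGroup n R :=
  vecTransvection (Pi.single i 1) x (by rw [dotProduct_single_one]; exact x.2)

theorem rowTransvection_add (i : n)
    (x y : LinearMap.ker (LinearMap.proj (R := R) (φ := fun _ : n => R) i)) :
    rowTransvection i (x + y) = rowTransvection i x * rowTransvection i y :=
  vecTransvection_mul_right _ _ _ _ _ _

/-- The vector `c e_j` as an element of the space of vectors vanishing at `i`. -/
def kerSingle {i j : n} (hij : i ≠ j) :
    R →+ LinearMap.ker (LinearMap.proj (R := R) (φ := fun _ : n => R) i) where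
  toFun c := ⟨Pi.single j c, by simp [hij]⟩
  map_zero' := by ext; simp
  map_add' c d := by ext; simp [Pi.single_add]

omit [Fintype n] in
theorem coe_kerSingle {i j : n} (hij : i ≠ j) (c : R) :
    (kerSingle hij c : n → R) = Pi.single j c := rfl

theorem rowTransvection_kerSingle {i j : n} (hij : i ≠ j) (c : R) :
    rowTransvection i (kerSingle hij c) = transvection hij c := by
  rw [← one_mul c]
  refine (vecTransvection_single hij 1 (1 * c) _).trans ?_
  rw [one_mul, one_mul]

/-- The action by conjugation of matrices having `e_i` as an eigenvector on the matrices
`1 + e_i xᵀ`. -/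
def rowAction (i : n) (g : SpecialLinearGroup n R) (c : R)
    (hg : ∀ k, g k i = c * (1 : Matrix n n R) k i) (d : R)
    (x : LinearMap.ker (LinearMap.proj (R := R) (φ := fun _ : n => R) i)) :
    LinearMap.ker (LinearMap.proj (R := R) (φ := fun _ : n => R) i) :=
  ⟨d • ((x : n → R) ᵥ* (g : Matrix n n R)), by
    have hx : (x : n → R) i = 0 := x.2
    simp [vecMul, dotProduct, hg, one_apply, hx]⟩

theorem rowTransvection_mul (i : n) (g : SpecialLinearGroup n R) (c : R)
    (hg : ∀ k, g k i = c * (1 : Matrix n n R) k i) (d : R) (hcd : c * d = 1)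
    (x : LinearMap.ker (LinearMap.proj (R := R) (φ := fun _ : n => R) i)) :
    rowTransvection i x * g = g * rowTransvection i (rowAction i g c hg d x) := by
  apply Subtype.ext
  simp only [coe_mul, rowTransvection, coe_vecTransvection, rowAction]
  rw [add_mul, mul_add, one_mul, mul_one, vecMulVec_mul, mul_vecMulVec]
  have : (g : Matrix n n R) *ᵥ Pi.single i 1 = c • Pi.single i 1 := by
    ext k
    simp [hg, one_apply, Pi.single_apply]
  rw [this, vecMulVec_smul, smul_vecMulVec, smul_smul, mul_comm d c, hcd, one_smul]

theorem rowAction_kerSingle {i j : n} (hij : i ≠ j) (g : SpecialLinearGroup n R) (c : R)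
    (hg : ∀ k, g k i = c * (1 : Matrix n n R) k i) (d t : R) :
    (rowAction i g c hg d (kerSingle hij t) : n → R) = fun l => d * (t * g j l) := by
  ext l
  simp [rowAction, coe_kerSingle, single_vecMul]

end Matrix.SpecialLinearGroup

/-- A representation of the special linear group over a local ring that is nontrivial is nontrivial
on an elementary transvection. -/
theorem exists_transvection_map_ne_one {n R V : Type*} [Fintype n] [DecidableEq n] [CommRing R]
    [IsLocalRing R] [AddCommGroup V] [Module ℂ V]
    {ρ : SpecialLinearGroup n R →* Module.End ℂ V} (h : ∃ g, ρ g ≠ 1) :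
    ∃ (i j : n) (hij : i ≠ j) (c : R), ρ (transvection hij c) ≠ 1 := by
  by_contra! hcon
  obtain ⟨g, hg⟩ := h
  have : ρ.ker = ⊤ :=
    eq_top_of_transvection_mem fun i j hij c => MonoidHom.mem_ker.2 (hcon i j hij c)
  exact hg (MonoidHom.mem_ker.1 (this ▸ Subgroup.mem_top g))

/-- Conjugation by `diag (a⁻¹, a)` turns a character `ψ` of the unipotent subgroup into
`t ↦ ψ (t a²)`, which gives `(p - 1) / 2` different characters. -/
theorem hasMinDegree_specialLinearGroup_two (p : ℕ) [Fact p.Prime] :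
    HasMinDegree (((p : ℝ) - 1) / 2) (SpecialLinearGroup (Fin 2) ℤ_[p]) := by
  intro V _ _ _ ρ hρ hne
  have hpos := finrank_pos_of_map_ne_one (f := ρ) hne
  obtain ⟨i, j, hij, c₀, hc₀⟩ := exists_transvection_map_ne_one hne
  rw [← rowTransvection_kerSingle] at hc₀
  obtain ⟨χ, hχ, hcard⟩ :=
    exists_addChar_card_le_finrank ρ hρ (rowTransvection i) (rowTransvection_add i) hc₀
  rcases (Fact.out : p.Prime).eq_two_or_odd with rfl | hodd
  · have : (1 : ℝ) ≤ Module.finrank ℂ V := by exact_mod_cast hpos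
    norm_num
    linarith
  have hu : ∀ a : Fin ((p - 1) / 2), IsUnit (((a : ℕ) + 1 : ℕ) : ℤ_[p]) := fun a =>
    PadicInt.isUnit_natCast_of_lt (by omega) (by have := a.2; omega)
  choose w hw using hu
  have hg : ∀ a k, diagPair hij.symm (w a) k i =
      ↑(w a)⁻¹ * (1 : Matrix (Fin 2) (Fin 2) ℤ_[p]) k i := by
    intro a k
    rw [coe_diagPair, diagonal_apply, one_apply]
    by_cases hk : k = i
    · subst hk
      simp [hij]
    · simp [hk]
  have h := hcard (Fin ((p - 1) / 2)) (fun a => diagPair hij.symm (w a))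
    (fun a => rowAction i _ _ (hg a) (w a))
    (fun a x => rowTransvection_mul i _ _ (hg a) _ (Units.inv_mul _) x) ?_
  · rw [Fintype.card_fin] at h
    have h2 : ((2 * ((p - 1) / 2) + 1 : ℕ) : ℝ) = p := by
      congr 1
      omega
    push_cast at h2
    have h3 : (((p - 1) / 2 : ℕ) : ℝ) ≤ Module.finrank ℂ V := by exact_mod_cast h
    linarith
  · intro a b hab
    by_contra hne
    let ψ : AddChar ℤ_[p] ℂ := χ.compAddMonoidHom (kerSingle hij)
    refine AddChar.not_isUnit_sub (ψ := ψ) (t₀ := c₀) hχ (a := (w a : ℤ_[p]) ^ 2)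
      (b := (w b : ℤ_[p]) ^ 2) (fun t => ?_) ?_
    · have key : ∀ a, rowAction i _ _ (hg a) (w a) (kerSingle hij t) =
          kerSingle hij (t * (w a : ℤ_[p]) ^ 2) := by
        intro a
        apply Subtype.ext
        rw [rowAction_kerSingle, coe_kerSingle]
        ext l
        rw [coe_diagPair, diagonal_apply]
        by_cases hl : l = j
        · subst hl
          simp only [if_true, Pi.single_eq_same]
          ring
        · simp [hl, Ne.symm hl]
      have h := congrFun hab (kerSingle hij t)
      simp only [key] at h
      exact h
    · rw [hw, hw]
      exact PadicInt.isUnit_sq_sub_sq a.2 b.2 (fun h => hne (Fin.ext h))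

/-- The characters of the group of matrices `1 + e_i xᵀ` are moved by a torus element scaling `e_j`
and by `1 + y e_jᵀ`; this gives `p - 1` times `p ^ (k - 2)` different characters. -/
theorem hasMinDegree_specialLinearGroup (p : ℕ) [Fact p.Prime] {k : ℕ} (hk : 3 ≤ k) :
    HasMinDegree ((p : ℝ) ^ (k - 1) - (p : ℝ) ^ (k - 2)) (SpecialLinearGroup (Fin k) ℤ_[p]) := by
  intro V _ _ _ ρ hρ hne
  obtain ⟨i, j, hij, c₀, hc₀⟩ := exists_transvection_map_ne_one hne
  rw [← rowTransvection_kerSingle] at hc₀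
  obtain ⟨χ, hχ, hcard⟩ :=
    exists_addChar_card_le_finrank ρ hρ (rowTransvection i) (rowTransvection_add i) hc₀
  obtain ⟨m, hm⟩ : ∃ m, m ∉ ({i, j} : Finset (Fin k)) := by
    by_contra! h
    have h1 : (Finset.univ : Finset (Fin k)) ⊆ {i, j} := fun x _ => h x
    have h2 := (Finset.card_le_card h1).trans Finset.card_le_two
    rw [Finset.card_univ, Fintype.card_fin] at h2
    omega
  simp only [Finset.mem_insert, Finset.mem_singleton, not_or] at hm
  obtain ⟨hmi, hmj⟩ := hm
  have hu : ∀ a : Fin (p - 1), IsUnit (((a : ℕ) + 1 : ℕ) : ℤ_[p]) := fun a =>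
    PadicInt.isUnit_natCast_of_lt (by omega) (by have := a.2; omega)
  choose w hw using hu
  let ι := {l : Fin k // l ∉ ({i, j} : Finset (Fin k))}
  let y : (ι → Fin p) → Fin k → ℤ_[p] := fun b l =>
    if h : l ∉ ({i, j} : Finset (Fin k)) then ((b ⟨l, h⟩ : ℕ) : ℤ_[p]) else 0
  have hyj : ∀ b, y b j = 0 := fun b => by simp [y]
  have hyi : ∀ b, y b i = 0 := fun b => by simp [y]
  let g : Fin (p - 1) × (ι → Fin p) → SpecialLinearGroup (Fin k) ℤ_[p] := fun a =>
    diagPair (Ne.symm hmj) (w a.1) * vecTransvection (y a.2) (Pi.single j 1) (by simp [hyj])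
  let d : Fin (p - 1) → Fin k → ℤ_[p] := fun a l =>
    if l = j then (w a : ℤ_[p]) else if l = m then ↑(w a)⁻¹ else 1
  have hd : ∀ a l, IsUnit (d a l) := by
    intro a l
    simp only [d]
    split_ifs
    · exact Units.isUnit _
    · exact Units.isUnit _
    · exact isUnit_one
  have hgapp : ∀ a r l, g a r l = d a.1 r * ((1 : Matrix (Fin k) (Fin k) ℤ_[p]) r l +
      y a.2 r * (Pi.single j 1 : Fin k → ℤ_[p]) l) := by
    intro a r l
    change (_ * (1 + vecMulVec (y a.2) (Pi.single j 1)) : Matrix (Fin k) (Fin k) ℤ_[p]) r l = _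
    rw [coe_diagPair, diagonal_mul]
    rfl
  have hg : ∀ a r, g a r i = 1 * (1 : Matrix (Fin k) (Fin k) ℤ_[p]) r i := by
    intro a r
    rw [hgapp, Pi.single_eq_of_ne hij, mul_zero, add_zero]
    by_cases hr : r = i
    · subst hr
      simp [d, hij, Ne.symm hmi]
    · simp [hr]
  have h := hcard (Fin (p - 1) × (ι → Fin p)) g
    (fun a => rowAction i _ _ (hg a) 1)
    (fun a x => rowTransvection_mul i _ _ (hg a) _ (one_mul 1) x) ?_
  · have hι : Fintype.card ι = k - 2 := by
      rw [Fintype.card_subtype_compl, Fintype.card_fin, Fintype.card_coe, Finset.card_pair hij]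
    rw [Fintype.card_prod, Fintype.card_fun, Fintype.card_fin, Fintype.card_fin, hι] at h
    have h2 : (((p - 1) * p ^ (k - 2) : ℕ) : ℝ) ≤ Module.finrank ℂ V := by exact_mod_cast h
    rw [Nat.cast_mul, Nat.cast_pow, Nat.cast_pred (Fact.out : p.Prime).pos] at h2
    refine le_trans (le_of_eq ?_) h2
    rw [show k - 1 = k - 2 + 1 by omega, pow_succ]
    ring
  · rintro ⟨a, b⟩ ⟨a', b'⟩ hab
    let ψ : AddChar ℤ_[p] ℂ := χ.compAddMonoidHom (kerSingle hij)
    have hψ : ψ c₀ ≠ 1 := hχ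
    -- Restricting to multiples of `e_j` shows that the diagonal parts agree.
    have haa' : a = a' := by
      by_contra hne
      refine AddChar.not_isUnit_sub hψ (a := (w a : ℤ_[p])) (b := (w a' : ℤ_[p])) (fun t => ?_) ?_
      · have key : ∀ a, rowAction i _ _ (hg a) 1 (kerSingle hij t) =
            kerSingle hij (t * (w a.1 : ℤ_[p])) := by
          intro a
          apply Subtype.ext
          rw [rowAction_kerSingle, coe_kerSingle]
          ext l
          rw [hgapp, hyj]
          by_cases hl : l = j
          · subst hl
            simp [d]
          · simp [hl, Ne.symm hl]
        have h := congrFun hab (kerSingle hij t)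
        simp only [key] at h
        exact h
      · rw [hw, hw]
        exact PadicInt.isUnit_natCast_sub_natCast (by omega) (by omega)
          (fun h => hne (Fin.ext (by omega)))
    subst haa'
    -- Restricting to multiples of the other basis vectors shows that the unipotent parts agree.
    refine Prod.ext rfl (funext fun ⟨l, hl⟩ => ?_)
    by_contra hne
    have hl' := hl
    simp only [Finset.mem_insert, Finset.mem_singleton, not_or] at hl'
    have hyl : ∀ b : ι → Fin p, y b l = ((b ⟨l, hl⟩ : ℕ) : ℤ_[p]) := fun b => dif_pos hl
    refine AddChar.not_isUnit_sub hψ (a := d a l * y b l) (b := d a l * y b' l) (fun t => ?_) ?_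
    · have key : ∀ b, rowAction i _ _ (hg (a, b)) 1 (kerSingle (Ne.symm hl'.1) t) =
          kerSingle (Ne.symm hl'.1) (t * d a l) + kerSingle hij (t * (d a l * y b l)) := by
        intro b
        apply Subtype.ext
        rw [rowAction_kerSingle, Submodule.coe_add, coe_kerSingle, coe_kerSingle]
        ext r
        rw [hgapp]
        simp only [one_apply, Pi.add_apply, Pi.single_apply, eq_comm (a := l)]
        split_ifs <;> ring
      have h := congrFun hab (kerSingle (Ne.symm hl'.1) t)
      simp only [key, AddChar.map_add_eq_mul] at h
      exact mul_left_cancel₀ (χ.val_isUnit _).ne_zero h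
    · rw [← mul_sub, hyl, hyl]
      exact (hd a l).mul (PadicInt.isUnit_natCast_sub_natCast (b _).2 (b' _).2
        (fun h => hne (Fin.ext h)))

end SpecialLinearDegree

/-! ### Generation of the symplectic group over a local ring -/

section Symplectic

open Matrix

/-- If `(A, C)` is the first half of a symplectic matrix over a field, then `A` becomes invertible
after adding `X C` for some symmetric `X`: once `A` is diagonal, `X` can be taken to be the
indicator of the zero entries of `A`. -/
theorem Matrix.exists_isSymm_isUnit_add_mul {n F : Type*} [Fintype n] [DecidableEq n] [Field F]
    {A C : Matrix n n F} (hAC : Aᵀ * C = Cᵀ * A)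
    (hker : ∀ x, A *ᵥ x = 0 → C *ᵥ x = 0 → x = 0) :
    ∃ X : Matrix n n F, X.IsSymm ∧ IsUnit (A + X * C) := by
  classical
  obtain ⟨L, L', d, hd⟩ := Pivot.exists_list_transvec_mul_mul_list_transvec_eq_diagonal A
  set P := (L.map TransvectionStruct.toMatrix).prod
  set Q := (L'.map TransvectionStruct.toMatrix).prod
  have hP : IsUnit P.det := by simp [P]
  have hQ : IsUnit Q.det := by simp [Q]
  have hPT : IsUnit Pᵀ.det := by rwa [det_transpose]
  set C' := Pᵀ⁻¹ * C * Q with hC'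
  -- In the new coordinates the symmetry relation reads `d j * C' j i = d i * C' i j`.
  have hsymm : (diagonal d)ᵀ * C' = C'ᵀ * diagonal d := by
    rw [← hd, hC']
    simp only [transpose_mul, transpose_nonsing_inv, transpose_transpose]
    calc Qᵀ * (Aᵀ * Pᵀ) * (Pᵀ⁻¹ * C * Q) = Qᵀ * Aᵀ * (Pᵀ * Pᵀ⁻¹) * C * Q := by
          simp only [Matrix.mul_assoc]
      _ = Qᵀ * (Aᵀ * C) * Q := by rw [mul_nonsing_inv _ hPT, Matrix.mul_one, Matrix.mul_assoc Qᵀ]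
      _ = Qᵀ * Cᵀ * (P⁻¹ * P) * A * Q := by
          rw [nonsing_inv_mul _ hP, Matrix.mul_one, hAC, ← Matrix.mul_assoc Qᵀ]
      _ = Qᵀ * (Cᵀ * P⁻¹) * (P * A * Q) := by simp only [Matrix.mul_assoc]
  have hsymm' : ∀ i j, d i * C' i j = C' j i * d j := by
    intro i j
    have := congrFun (congrFun hsymm i) j
    simpa [diagonal_transpose, diagonal_mul, mul_diagonal] using this
  let δ : n → F := fun i => if d i = 0 then 1 else 0
  refine ⟨P⁻¹ * diagonal δ * P⁻¹ᵀ, ?_, ?_⟩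
  · rw [IsSymm, transpose_mul, transpose_mul, transpose_transpose, diagonal_transpose,
      Matrix.mul_assoc]
  have hfact : A + P⁻¹ * diagonal δ * P⁻¹ᵀ * C = P⁻¹ * (diagonal d + diagonal δ * C') * Q⁻¹ := by
    rw [← hd, hC', transpose_nonsing_inv, Matrix.mul_add, Matrix.add_mul]
    congr 1
    · calc A = (P⁻¹ * P) * A * (Q * Q⁻¹) := by
            rw [nonsing_inv_mul _ hP, mul_nonsing_inv _ hQ, Matrix.one_mul, Matrix.mul_one]
        _ = _ := by simp only [Matrix.mul_assoc]
    · calc P⁻¹ * diagonal δ * Pᵀ⁻¹ * C = P⁻¹ * diagonal δ * Pᵀ⁻¹ * C * (Q * Q⁻¹) := by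
            rw [mul_nonsing_inv _ hQ, Matrix.mul_one]
        _ = _ := by simp only [Matrix.mul_assoc]
  rw [hfact]
  refine (IsUnit.mul ?_ ?_).mul ?_
  · exact (isUnit_iff_isUnit_det _).2 (isUnit_nonsing_inv_det _ hP)
  · rw [← mulVec_injective_iff_isUnit]
    rw [← coe_mulVecLin, ← LinearMap.ker_eq_bot, ker_mulVecLin_eq_bot_iff]
    intro x hx
    have hrow : ∀ i, d i * x i + δ i * (C' *ᵥ x) i = 0 := by
      intro i
      have := congrFun hx i
      rwa [add_mulVec, Pi.add_apply, ← mulVec_mulVec, mulVec_diagonal, mulVec_diagonal] at this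
    have hdx : ∀ i, d i * x i = 0 := by
      intro i
      by_cases hi : d i = 0
      · rw [hi, zero_mul]
      · simpa [δ, hi] using hrow i
    have hCx : C' *ᵥ x = 0 := by
      ext i
      by_cases hi : d i = 0
      · simpa [δ, hi] using hrow i
      · rw [mulVec, dotProduct, Pi.zero_apply]
        refine Finset.sum_eq_zero fun j _ => ?_
        refine mul_left_cancel₀ hi ?_
        rw [mul_zero, ← mul_assoc, hsymm', mul_assoc, hdx, mul_zero]
    have hQx : Q *ᵥ x = 0 := by
      refine hker _ ?_ ?_
      · have h1 : P *ᵥ (A *ᵥ (Q *ᵥ x)) = 0 := by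
          rw [mulVec_mulVec, mulVec_mulVec, hd]
          ext i
          rw [mulVec_diagonal, hdx, Pi.zero_apply]
        have h2 := congrArg (P⁻¹ *ᵥ ·) h1
        simpa [mulVec_mulVec, ← Matrix.mul_assoc, nonsing_inv_mul _ hP] using h2
      · have h1 : Pᵀ⁻¹ *ᵥ (C *ᵥ (Q *ᵥ x)) = 0 := by
          rw [mulVec_mulVec, mulVec_mulVec, hCx]
        have h2 := congrArg (Pᵀ *ᵥ ·) h1
        simpa [mulVec_mulVec, ← Matrix.mul_assoc, mul_nonsing_inv _ hPT] using h2
    have h2 := congrArg (Q⁻¹ *ᵥ ·) hQx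
    simpa [mulVec_mulVec, nonsing_inv_mul _ hQ] using h2
  · exact (isUnit_iff_isUnit_det _).2 (isUnit_nonsing_inv_det _ hQ)

namespace SymplecticGroup

variable {l R : Type*} [DecidableEq l] [CommRing R]

variable (l R) in
/-- The additive group of symmetric matrices. -/
def symmetricMatrices : AddSubgroup (Matrix l l R) where
  carrier := {S | S.IsSymm}
  zero_mem' := isSymm_zero
  add_mem' := IsSymm.add
  neg_mem' := IsSymm.neg

/-- The symmetric matrix `c E_ii`. -/
def symDiag (i : l) : R →+ symmetricMatrices l R where
  toFun c := ⟨single i i c, by simp [symmetricMatrices, IsSymm]⟩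
  map_zero' := by ext; simp
  map_add' c d := by ext; simp [single_add]

/-- The symmetric matrix `c (E_ij + E_ji)`. -/
def symPair (i j : l) : R →+ symmetricMatrices l R where
  toFun c := ⟨single i j c + single j i c, by simp [symmetricMatrices, IsSymm, add_comm]⟩
  map_zero' := by ext; simp
  map_add' c d := by
    ext : 1
    simp only [single_add, AddSubgroup.coe_add]
    abel

theorem coe_symDiag (i : l) (c : R) : (symDiag i c : Matrix l l R) = single i i c := rfl

theorem coe_symPair (i j : l) (c : R) :
    (symPair i j c : Matrix l l R) = single i j c + single j i c := rfl

variable [Fintype l]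

theorem exists_isSymm_isUnit_det_add_mul [IsLocalRing R] {A B C D : Matrix l l R}
    (h : fromBlocks A B C D ∈ symplecticGroup l R) :
    ∃ X : Matrix l l R, X.IsSymm ∧ IsUnit (A + X * C).det := by
  let f := IsLocalRing.residue R
  have hmap := map_mem h f
  rw [fromBlocks_map] at hmap
  obtain ⟨Y, hY, hYu⟩ := Matrix.exists_isSymm_isUnit_add_mul (fromBlocks_mem_iff.1 hmap).1 (by
    intro x hA hC
    have hu : IsUnit (fromBlocks (A.map f) (B.map f) (C.map f) (D.map f)) :=
      (isUnit_iff_isUnit_det _).2 (symplectic_det hmap)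
    have h0 : fromBlocks (A.map f) (B.map f) (C.map f) (D.map f) *ᵥ Sum.elim x 0 =
        fromBlocks (A.map f) (B.map f) (C.map f) (D.map f) *ᵥ Sum.elim 0 0 := by
      simp [fromBlocks_mulVec, hA, hC]
    exact (Sum.elim_eq_iff.1 (mulVec_injective_iff_isUnit.2 hu h0)).1)
  choose s hs using IsLocalRing.residue_surjective (R := R)
  refine ⟨Y.map s, hY.map s, ?_⟩
  rw [← IsLocalRing.residue_ne_zero_iff_isUnit, RingHom.map_det, map_add, map_mul]
  have : f.mapMatrix (Y.map s) = Y := by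
    ext i j
    exact hs _
  change (f.mapMatrix A + f.mapMatrix (Y.map s) * f.mapMatrix C).det ≠ 0
  rw [this]
  exact ((isUnit_iff_isUnit_det _).1 hYu).ne_zero

/-- The element `[1, S; 0, 1]` of the unipotent radical of the Siegel parabolic subgroup. -/
def upper (S : symmetricMatrices l R) : symplecticGroup l R :=
  ⟨fromBlocks 1 S 0 1, by
    have hS : (S : Matrix l l R)ᵀ = S := S.2
    simp [fromBlocks_mem_iff, hS]⟩

theorem coe_upper (S : symmetricMatrices l R) :
    (upper S : Matrix (l ⊕ l) (l ⊕ l) R) = fromBlocks 1 ↑S 0 1 := rfl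

theorem upper_add (S T : symmetricMatrices l R) : upper (S + T) = upper S * upper T := by
  apply Subtype.ext
  simp [coe_upper, fromBlocks_multiply, add_comm]

theorem upper_zero : upper (0 : symmetricMatrices l R) = 1 := by
  apply Subtype.ext
  simp [coe_upper]

/-- The Levi subgroup of the Siegel parabolic: `C` is sent to `[C⁻ᵀ, 0; 0, C]`. -/
def levi : GL l R →* symplecticGroup l R where
  toFun C := ⟨fromBlocks (↑C⁻¹ : Matrix l l R)ᵀ 0 0 C, by
    rw [fromBlocks_mem_iff]
    simp⟩
  map_one' := by
    apply Subtype.ext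
    simp
  map_mul' C D := by
    apply Subtype.ext
    simp [fromBlocks_multiply]

theorem coe_levi (C : GL l R) : (levi C : Matrix (l ⊕ l) (l ⊕ l) R) =
    fromBlocks (↑C⁻¹ : Matrix l l R)ᵀ 0 0 C := rfl

/-- The action `S ↦ Cᵀ S C` of the Levi subgroup on symmetric matrices. -/
def congruence (C : GL l R) (S : symmetricMatrices l R) : symmetricMatrices l R :=
  ⟨(C : Matrix l l R)ᵀ * (S : Matrix l l R) * C, by
    have hS : (S : Matrix l l R)ᵀ = S := S.2
    change ((C : Matrix l l R)ᵀ * (S : Matrix l l R) * (C : Matrix l l R))ᵀ = _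
    rw [transpose_mul, transpose_mul, transpose_transpose, hS, Matrix.mul_assoc]⟩

theorem coe_congruence (C : GL l R) (S : symmetricMatrices l R) :
    (congruence C S : Matrix l l R) = (C : Matrix l l R)ᵀ * (S : Matrix l l R) * C := rfl

theorem upper_mul_levi (C : GL l R) (S : symmetricMatrices l R) :
    upper S * levi C = levi C * upper (congruence C S) := by
  apply Subtype.ext
  have h : (↑C⁻¹ : Matrix l l R)ᵀ * (C : Matrix l l R)ᵀ = 1 := by
    rw [← transpose_mul, ← Units.val_mul, mul_inv_cancel, Units.val_one, transpose_one]
  simp only [Submonoid.coe_mul, coe_upper, coe_levi, coe_congruence, fromBlocks_multiply,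
    ← Matrix.mul_assoc, h]
  simp only [Matrix.one_mul, Matrix.mul_zero, Matrix.zero_mul, Matrix.mul_one, add_zero, zero_add]

theorem transpose_mul_single_mul_apply (C : Matrix l l R) (i j x y : l) (c : R) :
    (Cᵀ * single i j c * C) x y = C i x * c * C j y := by
  rw [mul_apply, Finset.sum_eq_single j]
  · rw [mul_single_apply_same, transpose_apply]
  · intro b _ hb
    rw [mul_single_apply_of_ne _ _ _ _ _ hb, zero_mul]
  · simp

theorem congruence_symDiag_apply (C : GL l R) (i : l) (c : R) (x y : l) :
    (congruence C (symDiag i c) : Matrix l l R) x y = C i x * c * C i y :=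
  transpose_mul_single_mul_apply _ _ _ _ _ _

theorem congruence_symPair_apply (C : GL l R) (i j : l) (c : R) (x y : l) :
    (congruence C (symPair i j c) : Matrix l l R) x y =
      C i x * c * C j y + C j x * c * C i y := by
  rw [coe_congruence, coe_symPair, Matrix.mul_add, Matrix.add_mul, Matrix.add_apply,
    transpose_mul_single_mul_apply, transpose_mul_single_mul_apply]

theorem coe_toGL_transvection_apply {i j : l} (hij : i ≠ j) (c : R) (x y : l) :
    (SpecialLinearGroup.toGL (SpecialLinearGroup.transvection hij c) : Matrix l l R) x y =
      (if x = y then 1 else 0) + if i = x ∧ j = y then c else 0 := by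
  change (1 + single i j c : Matrix l l R) x y = _
  rw [Matrix.add_apply, one_apply, single_apply]

theorem congruence_transvection_symDiag {i j : l} (hij : i ≠ j) (c : R) :
    congruence (SpecialLinearGroup.toGL (SpecialLinearGroup.transvection hij 1)) (symDiag i c) =
      symDiag i c + symDiag j c + symPair i j c := by
  ext x y
  rw [congruence_symDiag_apply, coe_toGL_transvection_apply, coe_toGL_transvection_apply]
  simp only [AddSubgroup.coe_add, Matrix.add_apply, coe_symDiag, coe_symPair, single_apply]
  grind

/-- The symplectic matrix that exchanges the `j`-th coordinates of the two halves, up to sign. -/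
def partialJ (j : l) : symplecticGroup l R :=
  ⟨fromBlocks (1 - single j j 1) (single j j 1) (-single j j 1) (1 - single j j 1), by
    rw [fromBlocks_mem_iff]
    simp [mul_sub, sub_mul]⟩

/-- All short root elements are conjugate: those in the Siegel unipotent radical are conjugate to
those in the Levi subgroup. -/
theorem upper_mul_partialJ {i j : l} (hij : i ≠ j) (c : R) :
    upper (symPair i j c) * partialJ j =
      partialJ j * levi (SpecialLinearGroup.toGL
        (SpecialLinearGroup.transvection (Ne.symm hij) c)) := by
  have h1 : ((SpecialLinearGroup.toGL (SpecialLinearGroup.transvection (Ne.symm hij) c) : GL l R) :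
      Matrix l l R) = 1 + single j i c := rfl
  have h2 : (((SpecialLinearGroup.toGL (SpecialLinearGroup.transvection (Ne.symm hij) c))⁻¹ :
      GL l R) : Matrix l l R) = 1 + single j i (-c) := by
    rw [← map_inv, SpecialLinearGroup.transvection_inv]
    rfl
  apply Subtype.ext
  simp only [Submonoid.coe_mul, coe_upper, coe_levi, partialJ, coe_symPair, fromBlocks_multiply,
    h1, h2]
  simp [mul_add, mul_sub, add_mul, sub_mul, hij, Ne.symm hij, single_neg]

/-- The element `[1, 0; S, 1]` of the opposite unipotent radical. -/
def lower (S : symmetricMatrices l R) : symplecticGroup l R :=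
  ⟨fromBlocks 1 0 S 1, by
    have hS : (S : Matrix l l R)ᵀ = S := S.2
    simp [fromBlocks_mem_iff, hS]⟩

theorem coe_lower (S : symmetricMatrices l R) :
    (lower S : Matrix (l ⊕ l) (l ⊕ l) R) = fromBlocks 1 0 ↑S 1 := rfl

theorem upper_mul_symJ (S : symmetricMatrices l R) :
    upper S * symJ l R = symJ l R * lower (-S) := by
  apply Subtype.ext
  simp [coe_upper, coe_lower, coe_J, J, fromBlocks_multiply]

/-! ### Normal subgroups of the symplectic group -/

variable {N : Subgroup (symplecticGroup l R)}

theorem _root_.Subgroup.Normal.mem_of_mul_eq_mul {G : Type*} [Group G] {N : Subgroup G}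
    (hN : N.Normal) {x y g : G} (h : x * g = g * y) (hx : x ∈ N) : y ∈ N := by
  rw [show y = g⁻¹ * x * g by rw [mul_assoc, h, inv_mul_cancel_left]]
  exact hN.conj_mem' x hx g

/-- Long root elements generate the short ones: `(e_i + e_j) (e_i + e_j)ᵀ` is conjugate to
`e_i e_iᵀ` under the Levi subgroup. -/
theorem upper_symPair_mem_of_symDiag (hN : N.Normal) (h : ∀ i c, upper (symDiag i c) ∈ N)
    {i j : l} (hij : i ≠ j) (c : R) : upper (symPair i j c) ∈ N := by
  have h1 := hN.mem_of_mul_eq_mul (upper_mul_levi (SpecialLinearGroup.toGL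
    (SpecialLinearGroup.transvection hij 1)) (symDiag i c)) (h i c)
  rw [congruence_transvection_symDiag, upper_add, upper_add] at h1
  exact (N.mul_mem_cancel_left (N.mul_mem (h i c) (h j c))).1 h1

theorem levi_transvection_mem (hN : N.Normal)
    (h : ∀ i j, i ≠ j → ∀ c, upper (symPair i j c) ∈ N) (i j : l) (hij : i ≠ j) (c : R) :
    levi (SpecialLinearGroup.toGL (SpecialLinearGroup.transvection hij c)) ∈ N :=
  hN.mem_of_mul_eq_mul (upper_mul_partialJ hij.symm c) (h j i hij.symm c)

/-- Short root elements generate the long ones: the commutator of `1 + E_ji` in the Levi subgroup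
with `E_jj` in the unipotent radical is `E_ii` up to a short root element. This needs no assumption
on the residue characteristic. -/
theorem upper_symDiag_mem_of_symPair [Nontrivial l] (hN : N.Normal)
    (h : ∀ i j, i ≠ j → ∀ c, upper (symPair i j c) ∈ N) (i : l) (c : R) :
    upper (symDiag i c) ∈ N := by
  obtain ⟨j, hji⟩ := exists_ne i
  have hl := levi_transvection_mem hN h j i hji 1
  have h1 := upper_mul_levi (SpecialLinearGroup.toGL
    (SpecialLinearGroup.transvection hji 1)) (symDiag j c)
  rw [congruence_transvection_symDiag, add_assoc, upper_add, ← mul_assoc] at h1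
  set t := levi (SpecialLinearGroup.toGL (SpecialLinearGroup.transvection hji (1 : R)))
  have h2 : upper (symDiag i c + symPair j i c) ∈ N := by
    have h3 : upper (symDiag i c + symPair j i c) =
        ((upper (symDiag j c))⁻¹ * t⁻¹ * upper (symDiag j c)) * t := by
      rw [mul_assoc _ _ t, h1]
      group
    rw [h3]
    exact N.mul_mem (hN.conj_mem' _ (N.inv_mem hl) _) hl
  rw [upper_add] at h2
  exact (N.mul_mem_cancel_right (h j i hji c)).1 h2

theorem upper_mem {k : ℕ} {N : Subgroup (symplecticGroup (Fin k) R)}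
    (hD : ∀ i c, upper (symDiag i c) ∈ N)
    (hP : ∀ i j, i ≠ j → ∀ c, upper (symPair i j c) ∈ N) (S : symmetricMatrices (Fin k) R) :
    upper S ∈ N := by
  have hsum : ∀ (t : Finset (Fin k)) (f : Fin k → symmetricMatrices (Fin k) R),
      (∀ i ∈ t, upper (f i) ∈ N) → upper (∑ i ∈ t, f i) ∈ N := by
    intro t f
    induction t using Finset.induction_on with
    | empty => exact fun _ => by simp [upper_zero]
    | insert a t ha ih =>
      intro hf
      rw [Finset.sum_insert ha, upper_add]
      exact N.mul_mem (hf a (Finset.mem_insert_self a t))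
        (ih fun i hi => hf i (Finset.mem_insert_of_mem hi))
  have hS : ∀ i j, (S : Matrix (Fin k) (Fin k) R) i j = (S : Matrix (Fin k) (Fin k) R) j i :=
    fun i j => congrFun (congrFun S.2 j) i
  have hdecomp : S = ∑ i, (symDiag i ((S : Matrix (Fin k) (Fin k) R) i i) +
      ∑ j ∈ Finset.univ.filter (i < ·), symPair i j ((S : Matrix (Fin k) (Fin k) R) i j)) := by
    ext x y
    have hpair : ∀ i j, ((if i < j then symPair i j ((S : Matrix (Fin k) (Fin k) R) i j) else 0 :
        symmetricMatrices (Fin k) R) : Matrix (Fin k) (Fin k) R) x y =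
        (if i = x then if j = y then if x < y then (S : Matrix (Fin k) (Fin k) R) x y else 0
          else 0 else 0) +
        (if i = y then if j = x then if y < x then (S : Matrix (Fin k) (Fin k) R) x y else 0
          else 0 else 0) := by
      intro i j
      have h1 := hS x y
      by_cases hij : i < j
      · rw [if_pos hij, coe_symPair, Matrix.add_apply, single_apply, single_apply]
        grind
      · rw [if_neg hij, AddSubgroup.coe_zero, Matrix.zero_apply]
        grind
    have hdiag : ∀ i, (symDiag i ((S : Matrix (Fin k) (Fin k) R) i i) :
        Matrix (Fin k) (Fin k) R) x y = if i = x then if x = y then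
          (S : Matrix (Fin k) (Fin k) R) x y else 0 else 0 := by
      intro i
      rw [coe_symDiag, single_apply]
      grind
    simp only [AddSubgroup.val_finsetSum, AddSubgroup.coe_add, Matrix.sum_apply, Matrix.add_apply,
      Finset.sum_add_distrib, Finset.sum_filter, hpair, hdiag, Finset.sum_ite_irrel,
      Finset.sum_const_zero, Finset.sum_ite_eq', Finset.mem_univ, if_true]
    rcases lt_trichotomy x y with hxy | hxy | hxy
    · simp [hxy, hxy.ne, hxy.not_gt]
    · simp [hxy]
    · simp [hxy, hxy.ne', hxy.not_gt]
  rw [hdecomp]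
  refine hsum _ _ fun i _ => ?_
  rw [upper_add]
  refine N.mul_mem (hD _ _) (hsum _ _ fun j hj => hP i j ?_ _)
  exact (Finset.mem_filter.1 hj).2.ne

/-- For symmetric `C` the matrix `[C⁻¹, 0; 0, C]` is the product of the Weyl-type elements
`[0, C⁻¹; -C, 0]` and `[0, -1; 1, 0]`, each of which is a product of three unipotents. -/
theorem levi_mem_of_isSymm (hN : N.Normal) (h : ∀ S, upper S ∈ N) (C : GL l R)
    (hC : (C : Matrix l l R).IsSymm) : levi C ∈ N := by
  have hlow : ∀ S, lower S ∈ N := by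
    intro S
    have := hN.mem_of_mul_eq_mul (upper_mul_symJ (-S)) (h _)
    rwa [neg_neg] at this
  have hC' : (↑C⁻¹ : Matrix l l R).IsSymm := by
    rw [coe_units_inv, IsSymm, transpose_nonsing_inv, hC.eq]
  let S : symmetricMatrices l R := ⟨↑C⁻¹, hC'⟩
  let S' : symmetricMatrices l R := ⟨C, hC⟩
  let I : symmetricMatrices l R := ⟨1, isSymm_one⟩
  have hprod : levi C = (upper S * lower (-S') * upper S) *
      (upper (-I) * lower I * upper (-I)) := by
    have h1 : (↑C⁻¹ : Matrix l l R) * (C : Matrix l l R) = 1 := by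
      rw [← Units.val_mul, inv_mul_cancel, Units.val_one]
    have h2 : (C : Matrix l l R) * (↑C⁻¹ : Matrix l l R) = 1 := by
      rw [← Units.val_mul, mul_inv_cancel, Units.val_one]
    apply Subtype.ext
    simp only [Submonoid.coe_mul, coe_upper, coe_levi, coe_lower, AddSubgroup.coe_neg, S, S', I,
      fromBlocks_multiply, hC'.eq]
    simp [-coe_units_inv, h1, h2]
  rw [hprod]
  exact N.mul_mem (N.mul_mem (N.mul_mem (h _) (hlow _)) (h _))
    (N.mul_mem (N.mul_mem (h _) (hlow _)) (h _))

/-- Over a local ring the Levi subgroup is generated by elementary transvections and the diagonal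
matrices with at most one entry different from `1`. -/
theorem levi_mem [IsLocalRing R] [Nonempty l] (hN : N.Normal) (h : ∀ S, upper S ∈ N)
    (C : GL l R) : levi C ∈ N := by
  have hSL : ∀ g : SpecialLinearGroup l R, levi (SpecialLinearGroup.toGL g) ∈ N := by
    have : N.comap (levi.comp SpecialLinearGroup.toGL) = ⊤ :=
      SpecialLinearGroup.eq_top_of_transvection_mem
        (levi_transvection_mem hN fun i j _ c => h _)
    intro g
    have hg : g ∈ N.comap (levi.comp SpecialLinearGroup.toGL) := this ▸ Subgroup.mem_top g
    exact hg
  let i₀ : l := Classical.arbitrary l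
  let a : Rˣ := GeneralLinearGroup.det C
  have hdet : ∀ b : Rˣ, (diagonal (Function.update (1 : l → R) i₀ b)).det = b := by
    intro b
    rw [det_diagonal, Finset.prod_update_of_mem (Finset.mem_univ _)]
    simp
  let d : GL l R := GeneralLinearGroup.mk'' (diagonal (Function.update (1 : l → R) i₀ a))
    (by rw [hdet]; exact a.isUnit)
  have hd : (d : Matrix l l R) = diagonal (Function.update (1 : l → R) i₀ a) := rfl
  let g : SpecialLinearGroup l R := ⟨((d⁻¹ * C : GL l R) : Matrix l l R), by
    have h1 : GeneralLinearGroup.det d = a := Units.ext (hdet a)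
    have h2 : GeneralLinearGroup.det (d⁻¹ * C) = 1 := by rw [map_mul, map_inv, h1]; exact inv_mul_cancel a
    exact congrArg Units.val h2⟩
  have hCg : C = d * SpecialLinearGroup.toGL g := by
    have : SpecialLinearGroup.toGL g = d⁻¹ * C := Units.ext rfl
    rw [this, mul_inv_cancel_left]
  rw [hCg, map_mul]
  refine N.mul_mem (levi_mem_of_isSymm hN h d ?_) (hSL g)
  rw [hd]
  exact isSymm_diagonal _

/-- The Siegel unipotent radical normally generates the symplectic group over a local ring: after
left multiplication by an element of it, the upper left block is invertible, and the matrix lies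
in the big cell. -/
theorem eq_top_of_upper_mem [IsLocalRing R] [Nonempty l] (hN : N.Normal)
    (h : ∀ S, upper S ∈ N) : N = ⊤ := by
  rw [Subgroup.eq_top_iff']
  intro M
  have hlow : ∀ S, lower S ∈ N := by
    intro S
    have := hN.mem_of_mul_eq_mul (upper_mul_symJ (-S)) (h _)
    rwa [neg_neg] at this
  obtain ⟨A, B, C, D, hM⟩ : ∃ A B C D, (M : Matrix (l ⊕ l) (l ⊕ l) R) = fromBlocks A B C D :=
    ⟨_, _, _, _, (fromBlocks_toBlocks _).symm⟩
  obtain ⟨X, hX, hXu⟩ := exists_isSymm_isUnit_det_add_mul (hM ▸ M.2)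
  let X' : symmetricMatrices l R := ⟨X, hX⟩
  set A' := A + X * C with hA'
  set B' := B + X * D with hB'
  have hM₁ : ((upper X' * M : symplecticGroup l R) : Matrix (l ⊕ l) (l ⊕ l) R) =
      fromBlocks A' B' C D := by
    rw [Submonoid.coe_mul, hM, coe_upper, fromBlocks_multiply]
    simp [X', hA', hB']
  have hM₁mem := (fromBlocks_mem_iff.1 (hM₁ ▸ (upper X' * M).2)).1
  have hAT : IsUnit A'ᵀ.det := by rwa [det_transpose]
  have hY : (-(C * A'⁻¹)).IsSymm := by
    refine IsSymm.neg ?_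
    rw [IsSymm, transpose_mul, transpose_nonsing_inv]
    calc A'ᵀ⁻¹ * Cᵀ = A'ᵀ⁻¹ * (Cᵀ * A') * A'⁻¹ := by
          rw [Matrix.mul_assoc, Matrix.mul_assoc, mul_nonsing_inv _ hXu, Matrix.mul_one]
      _ = C * A'⁻¹ := by
          rw [← hM₁mem, ← Matrix.mul_assoc, nonsing_inv_mul _ hAT, Matrix.one_mul]
  let Y : symmetricMatrices l R := ⟨-(C * A'⁻¹), hY⟩
  set D' := D - C * A'⁻¹ * B' with hD'
  have hM₂ : ((lower Y * (upper X' * M) : symplecticGroup l R) : Matrix (l ⊕ l) (l ⊕ l) R) =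
      fromBlocks A' B' 0 D' := by
    rw [Submonoid.coe_mul, hM₁, coe_lower, fromBlocks_multiply]
    simp only [Y, Matrix.neg_mul, Matrix.mul_assoc, nonsing_inv_mul _ hXu]
    simp [hD', Matrix.mul_assoc, sub_eq_neg_add]
  obtain ⟨-, hBD, hAD⟩ := fromBlocks_mem_iff.1 (hM₂ ▸ (lower Y * (upper X' * M)).2)
  rw [transpose_zero, Matrix.zero_mul, sub_zero] at hAD
  have hDA : D'ᵀ * A' = 1 := by
    simpa [transpose_mul] using congrArg transpose hAD
  have hDA' : D' * A'ᵀ = 1 := mul_eq_one_comm.1 hAD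
  let g : GL l R := ⟨D', A'ᵀ, hDA', hAD⟩
  let Z : symmetricMatrices l R := ⟨D'ᵀ * B', by
    change (D'ᵀ * B')ᵀ = D'ᵀ * B'
    rw [transpose_mul, transpose_transpose, hBD]⟩
  have hM₃ : lower Y * (upper X' * M) = levi g * upper Z := by
    apply Subtype.ext
    have hg : (↑g⁻¹ : Matrix l l R) = A'ᵀ := rfl
    have hg' : (g : Matrix l l R) = D' := rfl
    rw [hM₂, Submonoid.coe_mul, coe_levi, coe_upper, fromBlocks_multiply, hg, hg']
    have : A' * (D'ᵀ * B') = B' := by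
      rw [← Matrix.mul_assoc, mul_eq_one_comm.1 hDA, Matrix.one_mul]
    simp [Z, this]
  have h3 : lower Y * (upper X' * M) ∈ N := hM₃ ▸ N.mul_mem (levi_mem hN h g) (h Z)
  exact (N.mul_mem_cancel_left (h X')).1 ((N.mul_mem_cancel_left (hlow Y)).1 h3)

end SymplecticGroup

end Symplectic

/-! ### The minimal degree of the symplectic group -/

section SymplecticDegree

open Matrix SymplecticGroup

/-- A nontrivial representation of the symplectic group is nontrivial on a long root subgroup. -/
theorem exists_symDiag_map_ne_one {R V : Type*} [CommRing R] [IsLocalRing R] [AddCommGroup V]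
    [Module ℂ V] {k : ℕ} (hk : 0 < k) {ρ : symplecticGroup (Fin k) R →* Module.End ℂ V}
    (h : ∃ g, ρ g ≠ 1) : ∃ i c, ρ (upper (symDiag i c)) ≠ 1 := by
  by_contra! hcon
  obtain ⟨g, hg⟩ := h
  have : Nonempty (Fin k) := ⟨⟨0, hk⟩⟩
  have hD : ∀ i c, upper (symDiag i c) ∈ ρ.ker := fun i c => MonoidHom.mem_ker.2 (hcon i c)
  have htop : ρ.ker = ⊤ := eq_top_of_upper_mem inferInstance
    (upper_mem hD fun i j hij c => upper_symPair_mem_of_symDiag inferInstance hD hij c)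
  exact hg (MonoidHom.mem_ker.1 (htop ▸ Subgroup.mem_top g))

/-- A nontrivial representation of the symplectic group is nontrivial on a short root subgroup. -/
theorem exists_symPair_map_ne_one {R V : Type*} [CommRing R] [IsLocalRing R] [AddCommGroup V]
    [Module ℂ V] {k : ℕ} (hk : 2 ≤ k) {ρ : symplecticGroup (Fin k) R →* Module.End ℂ V}
    (h : ∃ g, ρ g ≠ 1) : ∃ i j, i ≠ j ∧ ∃ c, ρ (upper (symPair i j c)) ≠ 1 := by
  by_contra! hcon
  have : Nontrivial (Fin k) := Fin.nontrivial_iff_two_le.2 hk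
  obtain ⟨i, c, hic⟩ := exists_symDiag_map_ne_one (by omega) h
  exact hic (MonoidHom.mem_ker.1 (upper_symDiag_mem_of_symPair inferInstance
    (fun i j hij c => MonoidHom.mem_ker.2 (hcon i j hij c)) i c))

variable {p : ℕ} [Fact p.Prime]

/-- For odd `p` the orbit of a character that is nontrivial on a long root subgroup is large. -/
theorem half_mul_pow_le_finrank_symplecticGroup {V : Type*} [AddCommGroup V] [Module ℂ V]
    [FiniteDimensional ℂ V] {k : ℕ} (hk : 0 < k) (hp : p ≠ 2)
    (ρ : symplecticGroup (Fin k) ℤ_[p] →* Module.End ℂ V)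
    (hρ : ∃ m : ℕ, 0 < m ∧ ∀ g, ρ g ^ m = 1) (hne : ∃ g, ρ g ≠ 1) :
    (p - 1) / 2 * p ^ (k - 1) ≤ Module.finrank ℂ V := by
  have hp2 : 2 < p := lt_of_le_of_ne (Fact.out : p.Prime).two_le hp.symm
  obtain ⟨i, c₀, hc₀⟩ := exists_symDiag_map_ne_one hk hne
  obtain ⟨χ, hχ, hcard⟩ := exists_addChar_card_le_finrank ρ hρ upper upper_add hc₀
  have hu : ∀ a : Fin ((p - 1) / 2), IsUnit (((a : ℕ) + 1 : ℕ) : ℤ_[p]) := fun a =>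
    PadicInt.isUnit_natCast_of_lt (by omega) (by have := a.2; omega)
  choose w hw using hu
  let ι := {r : Fin k // r ∉ ({i} : Finset (Fin k))}
  let y : (ι → Fin p) → Fin k → ℤ_[p] := fun b r =>
    if h : r ∉ ({i} : Finset (Fin k)) then ((b ⟨r, h⟩ : ℕ) : ℤ_[p]) else 0
  have hyi : ∀ b, y b i = 0 := fun b => by simp [y]
  let d : Fin ((p - 1) / 2) → Fin k → ℤ_[p] := fun a => Function.update 1 i (w a : ℤ_[p])
  have hd : ∀ a, IsUnit (diagonal (d a)).det := by
    intro a
    rw [det_diagonal, Finset.prod_update_of_mem (Finset.mem_univ _)]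
    simp
  let g : Fin ((p - 1) / 2) × (ι → Fin p) → GL (Fin k) ℤ_[p] := fun a =>
    GeneralLinearGroup.mk'' (diagonal (d a.1)) (hd a.1) * SpecialLinearGroup.toGL
      (SpecialLinearGroup.vecTransvection (y a.2) (Pi.single i 1) (by simp [hyi]))
  have hgapp : ∀ a r s, g a r s = d a.1 r * ((1 : Matrix (Fin k) (Fin k) ℤ_[p]) r s +
      y a.2 r * (Pi.single i 1 : Fin k → ℤ_[p]) s) := by
    intro a r s
    change (diagonal (d a.1) * (1 + vecMulVec (y a.2) (Pi.single i 1)) :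
      Matrix (Fin k) (Fin k) ℤ_[p]) r s = _
    rw [diagonal_mul]
    rfl
  have hgi : ∀ a s, g a i s = if i = s then (w a.1 : ℤ_[p]) else 0 := by
    intro a s
    rw [hgapp, hyi, zero_mul, add_zero, one_apply]
    simp [d]
  have hgr : ∀ a r s, r ≠ i → g a r s = (if r = s then 1 else 0) + if i = s then y a.2 r else 0 := by
    intro a r s hr
    rw [hgapp, one_apply, Pi.single_apply]
    simp [d, hr, eq_comm]
  have h := hcard (Fin ((p - 1) / 2) × (ι → Fin p)) (fun a => levi (g a))
    (fun a => congruence (g a)) (fun a x => upper_mul_levi (g a) x) ?_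
  · have hι : Fintype.card ι = k - 1 := by
      rw [Fintype.card_subtype_compl, Fintype.card_fin, Fintype.card_coe, Finset.card_singleton]
    rwa [Fintype.card_prod, Fintype.card_fun, Fintype.card_fin, Fintype.card_fin, hι] at h
  · rintro ⟨a, b⟩ ⟨a', b'⟩ hab
    let ψ : AddChar ℤ_[p] ℂ := χ.compAddMonoidHom (symDiag i)
    have hψ : ψ c₀ ≠ 1 := hχ
    -- On the long root subgroup the conjugates differ by the square of the diagonal entry.
    have haa' : a = a' := by
      by_contra hne
      refine AddChar.not_isUnit_sub hψ (a := (w a : ℤ_[p]) ^ 2) (b := (w a' : ℤ_[p]) ^ 2)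
        (fun t => ?_) ?_
      · have key : ∀ a, congruence (g a) (symDiag i t) = symDiag i (t * (w a.1 : ℤ_[p]) ^ 2) := by
          intro a
          ext r s
          rw [congruence_symDiag_apply, hgi, hgi, coe_symDiag, single_apply]
          simp only [ite_and]
          split_ifs <;> ring
        have h := congrFun hab (symDiag i t)
        simp only [key] at h
        exact h
      · rw [hw, hw]
        exact PadicInt.isUnit_sq_sub_sq a.2 a'.2 (fun h => hne (Fin.ext h))
    subst haa'
    -- On the short root subgroups they differ by twice the unipotent part.
    refine Prod.ext rfl (funext fun ⟨r, hr⟩ => ?_)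
    by_contra hne
    have hri : r ≠ i := by simpa using hr
    have hyr : ∀ b : ι → Fin p, y b r = ((b ⟨r, hr⟩ : ℕ) : ℤ_[p]) := fun b => dif_pos hr
    refine AddChar.not_isUnit_sub hψ (a := 2 * w a * y b r) (b := 2 * w a * y b' r)
      (fun t => ?_) ?_
    · have key : ∀ b, congruence (g (a, b)) (symPair i r t) =
          symPair i r (t * w a) + symDiag i (t * (2 * w a * y b r)) := by
        intro b
        ext s s'
        rw [congruence_symPair_apply, hgi, hgi, hgr _ _ _ hri, hgr _ _ _ hri, AddSubgroup.coe_add,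
          Matrix.add_apply, coe_symDiag, coe_symPair, Matrix.add_apply, single_apply, single_apply,
          single_apply]
        simp only [ite_and]
        split_ifs <;> ring
      have h := congrFun hab (symPair i r t)
      simp only [key, AddChar.map_add_eq_mul] at h
      exact mul_left_cancel₀ (χ.val_isUnit _).ne_zero h
    · rw [← mul_sub, hyr, hyr]
      have h2 : IsUnit (2 : ℤ_[p]) := by
        exact_mod_cast PadicInt.isUnit_natCast_of_lt (p := p) two_pos hp2
      exact (h2.mul (w a).isUnit).mul (PadicInt.isUnit_natCast_sub_natCast (b _).2 (b' _).2
        (fun h => hne (Fin.ext h)))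

/-- The orbit of a character that is nontrivial on a short root subgroup, under row operations that
preserve this subgroup. -/
theorem pow_le_finrank_symplecticGroup {V : Type*} [AddCommGroup V] [Module ℂ V]
    [FiniteDimensional ℂ V] {k : ℕ} (hk : 2 ≤ k)
    (ρ : symplecticGroup (Fin k) ℤ_[p] →* Module.End ℂ V)
    (hρ : ∃ m : ℕ, 0 < m ∧ ∀ g, ρ g ^ m = 1) (hne : ∃ g, ρ g ≠ 1) :
    p ^ (k - 2) ≤ Module.finrank ℂ V := by
  obtain ⟨i, j, hij, c₀, hc₀⟩ := exists_symPair_map_ne_one hk hne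
  obtain ⟨χ, hχ, hcard⟩ := exists_addChar_card_le_finrank ρ hρ upper upper_add hc₀
  let ι := {r : Fin k // r ∉ ({i, j} : Finset (Fin k))}
  let y : (ι → Fin p) → Fin k → ℤ_[p] := fun b r =>
    if h : r ∉ ({i, j} : Finset (Fin k)) then ((b ⟨r, h⟩ : ℕ) : ℤ_[p]) else 0
  have hyi : ∀ b, y b i = 0 := fun b => by simp [y]
  have hyj : ∀ b, y b j = 0 := fun b => by simp [y]
  let g : (ι → Fin p) → GL (Fin k) ℤ_[p] := fun b => SpecialLinearGroup.toGL
    (SpecialLinearGroup.vecTransvection (y b) (Pi.single j 1) (by simp [hyj]))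
  have hg : ∀ b r s, g b r s = (if r = s then 1 else 0) + if j = s then y b r else 0 := by
    intro b r s
    change (1 + vecMulVec (y b) (Pi.single j 1) : Matrix (Fin k) (Fin k) ℤ_[p]) r s = _
    rw [Matrix.add_apply, one_apply, vecMulVec_apply, Pi.single_apply]
    simp [eq_comm]
  have h := hcard (ι → Fin p) (fun b => levi (g b)) (fun b => congruence (g b))
    (fun b x => upper_mul_levi (g b) x) ?_
  · have hι : Fintype.card ι = k - 2 := by
      rw [Fintype.card_subtype_compl, Fintype.card_fin, Fintype.card_coe, Finset.card_pair hij]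
    rwa [Fintype.card_fun, Fintype.card_fin, hι] at h
  · intro b b' hab
    let ψ : AddChar ℤ_[p] ℂ := χ.compAddMonoidHom (symPair i j)
    have hψ : ψ c₀ ≠ 1 := hχ
    refine funext fun ⟨r, hr⟩ => ?_
    by_contra hne
    have hyr : ∀ b : ι → Fin p, y b r = ((b ⟨r, hr⟩ : ℕ) : ℤ_[p]) := fun b => dif_pos hr
    refine AddChar.not_isUnit_sub hψ (a := y b r) (b := y b' r) (fun t => ?_) ?_
    · have key : ∀ b, congruence (g b) (symPair i r t) =
          symPair i r t + symPair i j (t * y b r) := by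
        intro b
        ext s s'
        rw [congruence_symPair_apply, hg, hg, hg, hg, hyi, AddSubgroup.coe_add,
          Matrix.add_apply, coe_symPair, coe_symPair, Matrix.add_apply, Matrix.add_apply,
          single_apply, single_apply, single_apply, single_apply]
        simp only [ite_and]
        split_ifs <;> ring
      have h := congrFun hab (symPair i r t)
      simp only [key, AddChar.map_add_eq_mul] at h
      exact mul_left_cancel₀ (χ.val_isUnit _).ne_zero h
    · rw [hyr, hyr]
      exact PadicInt.isUnit_natCast_sub_natCast (b _).2 (b' _).2 (fun h => hne (Fin.ext h))

theorem hasMinDegree_symplecticGroup (p : ℕ) [Fact p.Prime] {k : ℕ} (hk : 2 ≤ k) :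
    HasMinDegree (1 / 2 * ((p : ℝ) - 1) * (p : ℝ) ^ (k - 1)) (symplecticGroup (Fin k) ℤ_[p]) := by
  intro V _ _ _ ρ hρ hne
  by_cases hp : p = 2
  · subst hp
    have h : ((2 ^ (k - 2) : ℕ) : ℝ) ≤ Module.finrank ℂ V := by
      exact_mod_cast pow_le_finrank_symplecticGroup hk ρ hρ hne
    refine le_trans (le_of_eq ?_) h
    rw [show k - 1 = k - 2 + 1 by omega, pow_succ]
    push_cast
    ring
  · have h : (((p - 1) / 2 * p ^ (k - 1) : ℕ) : ℝ) ≤ Module.finrank ℂ V := by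
      exact_mod_cast half_mul_pow_le_finrank_symplecticGroup (by omega) hp ρ hρ hne
    refine le_trans (le_of_eq ?_) h
    have h2 : ((2 * ((p - 1) / 2) + 1 : ℕ) : ℝ) = p := by
      congr 1
      have := (Fact.out : p.Prime).eq_two_or_odd
      omega
    push_cast at h2 ⊢
    rw [← h2]
    ring

end SymplecticDegree

/-! ### Bounds for the product-free measure -/

section Bounds

open Matrix

variable {p : ℕ} [Fact p.Prime]

theorem totallyDisconnectedSpace_matrix (m : Type*) :
    TotallyDisconnectedSpace (Matrix m m ℤ_[p]) :=
  inferInstanceAs (TotallyDisconnectedSpace (m → m → ℤ_[p]))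

instance (k : ℕ) : TotallyDisconnectedSpace (SpecialLinearGroup (Fin k) ℤ_[p]) :=
  have := totallyDisconnectedSpace_matrix (p := p) (Fin k)
  inferInstanceAs (TotallyDisconnectedSpace {A : Matrix (Fin k) (Fin k) ℤ_[p] // A.det = 1})

instance (k : ℕ) : TotallyDisconnectedSpace (symplecticGroup (Fin k) ℤ_[p]) :=
  have := totallyDisconnectedSpace_matrix (p := p) (Fin k ⊕ Fin k)
  inferInstanceAs (TotallyDisconnectedSpace
    {A : Matrix (Fin k ⊕ Fin k) (Fin k ⊕ Fin k) ℤ_[p] // A ∈ symplecticGroup (Fin k) ℤ_[p]})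

theorem le_productFreeMeasure_specialLinearGroup (p : ℕ) [Fact p.Prime] {k : ℕ} (hk : 2 ≤ k) :
    ((p : ℝ) - 1) / ((p : ℝ) ^ k - 1) ≤
      productFreeMeasure (SpecialLinearGroup (Fin k) ℤ_[p]) := by
  have : Nontrivial (Fin k) := Fin.nontrivial_iff_two_le.2 hk
  obtain ⟨i, j, hij⟩ := exists_pair_ne (Fin k)
  have h := div_le_productFreeMeasure_of_hom (p := p)
    (MonoidHom.id (SpecialLinearGroup (Fin k) ℤ_[p]))
    (fun i j => by exact (continuous_apply_apply i j).comp continuous_subtype_val) hij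
    (SpecialLinearGroup.transvection hij 1)
    (by simp [SpecialLinearGroup.transvection_coe, hij])
  simpa using h

/-- The inclusion of the symplectic group in the special linear group. -/
def symplecticToSpecialLinear (k : ℕ) :
    symplecticGroup (Fin k) ℤ_[p] →* SpecialLinearGroup (Fin k ⊕ Fin k) ℤ_[p] where
  toFun g := ⟨g, SymplecticGroup.det_eq_one g.2⟩
  map_one' := rfl
  map_mul' _ _ := rfl

theorem symplecticToSpecialLinear_apply {k : ℕ} (g : symplecticGroup (Fin k) ℤ_[p])
    (i j : Fin k ⊕ Fin k) :
    symplecticToSpecialLinear k g i j = (g : Matrix (Fin k ⊕ Fin k) (Fin k ⊕ Fin k) ℤ_[p]) i j := rfl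

theorem le_productFreeMeasure_symplecticGroup (p : ℕ) [Fact p.Prime] {k : ℕ} (hk : 0 < k) :
    ((p : ℝ) - 1) / ((p : ℝ) ^ (2 * k) - 1) ≤
      productFreeMeasure (symplecticGroup (Fin k) ℤ_[p]) := by
  have h := div_le_productFreeMeasure_of_hom (p := p) (symplecticToSpecialLinear k)
    (fun i j => by exact (continuous_apply_apply i j).comp continuous_subtype_val)
    (i₀ := Sum.inl ⟨0, hk⟩) (i₁ := Sum.inr ⟨0, hk⟩) (by simp) (SymplecticGroup.symJ (Fin k) ℤ_[p])
    (by simp [symplecticToSpecialLinear_apply, SymplecticGroup.coe_J, J])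
  rwa [Fintype.card_sum, Fintype.card_fin, ← two_mul] at h

end Bounds

theorem mainTheorem4 (p : ℕ) [Fact p.Prime] :
    (1 / ((p : ℝ) + 1) ≤ productFreeMeasure (Matrix.SpecialLinearGroup (Fin 2) ℤ_[p]) ∧
      productFreeMeasure (Matrix.SpecialLinearGroup (Fin 2) ℤ_[p]) ≤
        (((p : ℝ) - 1) / 2) ^ (-(1 / 3) : ℝ)) ∧
    (∀ k : ℕ, 3 ≤ k →
      ((p : ℝ) - 1) / ((p : ℝ) ^ k - 1) ≤
          productFreeMeasure (Matrix.SpecialLinearGroup (Fin k) ℤ_[p]) ∧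
        productFreeMeasure (Matrix.SpecialLinearGroup (Fin k) ℤ_[p]) ≤
          ((p : ℝ) ^ (k - 1) - (p : ℝ) ^ (k - 2)) ^ (-(1 / 3) : ℝ)) ∧
    (∀ k : ℕ, 2 ≤ k →
      ((p : ℝ) - 1) / ((p : ℝ) ^ (2 * k) - 1) ≤
          productFreeMeasure (Matrix.symplecticGroup (Fin k) ℤ_[p]) ∧
        productFreeMeasure (Matrix.symplecticGroup (Fin k) ℤ_[p]) ≤
          (1 / 2 * ((p : ℝ) - 1) * (p : ℝ) ^ (k - 1)) ^ (-(1 / 3) : ℝ)) := by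
  have hp : (1 : ℝ) < p := by exact_mod_cast (Fact.out : p.Prime).one_lt
  refine ⟨⟨?_, productFreeMeasure_le (by linarith) (hasMinDegree_specialLinearGroup_two p)⟩,
    fun k hk => ⟨le_productFreeMeasure_specialLinearGroup p (by omega),
      productFreeMeasure_le ?_ (hasMinDegree_specialLinearGroup p hk)⟩,
    fun k hk => ⟨le_productFreeMeasure_symplecticGroup p (by omega),
      productFreeMeasure_le ?_ (hasMinDegree_symplecticGroup p hk)⟩⟩
  · refine le_trans (le_of_eq ?_) (le_productFreeMeasure_specialLinearGroup p le_rfl)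
    rw [show (p : ℝ) ^ 2 - 1 = (p + 1) * (p - 1) by ring, div_mul_cancel_right₀ (by linarith),
      one_div]
  · exact sub_pos.2 (pow_lt_pow_right₀ hp (by omega))
  · have : 0 < (p : ℝ) - 1 := by linarith
    positivity
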